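/- Notation. For a finite-dimensional complex vector space $V$, $\mathrm{Sym}^{1,1}(V)\subset V\otimes\bar V$ denotes the Hermitian sesquilinear forms on $V^*$; a positive definite $h\in\mathrm{Sym}^{1,1}(V)$ has an inverse $h^{-1}$, a Hermitian metric on $V$. For a complex Lie algebra $\mathfrak g$ let $\#$ be the bilinear operation on $\mathfrak g\otimes\bar{\mathfrak g}$ with $(v_1\otimes\bar v_2)\#(w_1\otimes\bar w_2)=[v_1,w_1]\otimes\overline{[v_2,w_2]}$, and put $h^\#=\tfrac12\,h\#h$ for $h\in\mathrm{Sym}^{1,1}(\mathfrak g)$. On a complex manifold, the Hermitian curvature flow (HCF) of Hermitian metrics is $$\partial_t g_{i\bar j}=-\Theta_{i\bar j}(g(t)),\qquad g(0)=g_0,\qquad \Theta_{i\bar j}=g^{m\bar n}\Omega_{m\bar n i\bar j}+\tfrac12\, g^{m\bar n}g^{p\bar s}T_{mp\bar j}T_{\bar n\bar s i},$$ where $\Omega$ and $T$ are the curvature and the torsion of the Chern connection of $g$. A solution on $[0,\tau)$ is a family of Hermitian metrics, smooth on $[0,\tau)\times M$, that satisfies this equation (at $t=0$ with the one-sided time derivative).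 Let $G$ be a complex Lie group with Lie algebra $\mathfrak g$, and let $M=G/H$ be a complex homogeneous manifold: $G$ acts on $M$ holomorphically and transitively with isotropy subgroup $H$, and $G\to G/H=M$ is a holomorphic submersion. Let $\mathrm{ev}_x:\mathfrak g\to T_xM$ be the (surjective) differential at $1$ of $a\mapsto a\cdot x$. For a Hermitian metric $k$ on $\mathfrak g$, $\mathrm{ev}_*k$ is the metric on $M$ that at each $x$ is the restriction of $k$ to the $k$-orthogonal complement $(\ker \mathrm{ev}_x)^\perp$, transported to $T_xM$ by the isomorphism $\mathrm{ev}_x:(\ker\mathrm{ev}_x)^\perp\to T_xM$. Let $\mathcal M^{\rm ind}(M)$ be the set of all $\mathrm{ev}_*k$. Theorem. Let $G$ be a complex Lie group with Lie algebra $\mathfrak g$. (1) Let $h_0\in\mathrm{Sym}^{1,1}(\mathfrak g)$ be positive definite, $0<\tau\le\infty$, and let $h:[0,\tau)\to\mathrm{Sym}^{1,1}(\mathfrak g)$ solve the ODE $$\partial_t h=h^\#,\qquad h(0)=h_0.$$ Then for every isotropy subgroup $H$ and every complex homogeneous manifold $M=G/H$, $g(t)=\mathrm{ev}_*(h(t)^{-1})$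 is a solution on $[0,\tau)$ of the HCF on $M$ with initial metric $g_0=\mathrm{ev}_*(h_0^{-1})$, and $g(t)\in\mathcal M^{\rm ind}(M)$ for all $t\in[0,\tau)$. (2) The HCF preserves induced metrics: for every complex homogeneous manifold $M=G/H$ and every $g_0\in\mathcal M^{\rm ind}(M)$ there are $\tau>0$ and a solution $g(t)$, $t\in[0,\tau)$, of the HCF on $M$ with $g(0)=g_0$ and $g(t)\in\mathcal M^{\rm ind}(M)$ for all $t\in[0,\tau)$. -/

import Mathlib

open scoped Manifold ContDiff ComplexConjugate

noncomputable section

namespace HCF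

/-! ### Hermitian forms on complex vector spaces -/

/-- Sesquilinear forms on a complex vector space: linear in the first argument and
conjugate-linear in the second one. -/
abbrev SesqForm (W : Type*) [AddCommGroup W] [Module ℂ W] : Type _ := W →ₗ[ℂ] W →ₗ⋆[ℂ] ℂ

section Forms

variable {W : Type*} [AddCommGroup W] [Module ℂ W]

/-- Hermitian symmetry `k(v, w) = conj k(w, v)`. -/
def IsHermitian (k : SesqForm W) : Prop := ∀ v w : W, k v w = conj (k w v)

/-- Positivity of a Hermitian form: `k(v, v) > 0` for all `v ≠ 0`. -/
def IsPositive (k : SesqForm W) : Prop := ∀ v : W, v ≠ 0 → 0 < (k v v).re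

/-- A Hermitian metric (inner product) on a complex vector space. -/
def IsHermitianInner (k : SesqForm W) : Prop := IsHermitian k ∧ IsPositive k

end Forms

/-- `Sym^{1,1}(V) ⊆ V ⊗ conj V`: the Hermitian sesquilinear forms on the dual space `V^*`. -/
def Sym11 (V : Type*) [AddCommGroup V] [Module ℂ V] : Type _ :=
  {h : SesqForm (Module.Dual ℂ V) // IsHermitian h}

/-- The element `v ⊗ conj w` of `V ⊗ conj V`, as a sesquilinear form on `V^*`:
`(ξ, η) ↦ ξ(v) * conj (η(w))`. -/
def tensorForm {V : Type*} [AddCommGroup V] [Module ℂ V] (v w : V) :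
    SesqForm (Module.Dual ℂ V) :=
  LinearMap.mk₂'ₛₗ (RingHom.id ℂ) (starRingEnd ℂ) (fun ξ η => ξ v * conj (η w))
    (fun _ _ _ => by simp [add_mul]) (fun _ _ _ => by simp [mul_assoc])
    (fun _ _ _ => by simp [mul_add]) (fun _ _ _ => by simp [mul_left_comm])

/-! ### The operation `#` on a complex Lie algebra -/

section Sharp

variable {L : Type*} [LieRing L] [LieAlgebra ℂ L] [FiniteDimensional ℂ L]

/-- The bilinear operation `#` on `L ⊗ conj L` (sesquilinear forms on `L^*`). In a basis `e_α`, with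
`h = ∑ h^{εγ} e_ε ⊗ conj e_γ` and `k = ∑ k^{δθ} e_δ ⊗ conj e_θ`, it is
`h # k = ∑ h^{εγ} k^{δθ} [e_ε, e_δ] ⊗ conj [e_γ, e_θ]`. -/
def sharpForm (h k : SesqForm (Module.Dual ℂ L)) : SesqForm (Module.Dual ℂ L) :=
  let e := Module.finBasis ℂ L
  ∑ ε, ∑ γ, ∑ δ, ∑ θ,
    (h (e.coord ε) (e.coord γ) * k (e.coord δ) (e.coord θ)) • tensorForm ⁅e ε, e δ⁆ ⁅e γ, e θ⁆

/-- The defining property of `#`, free of the choice of a basis: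
`(v₁ ⊗ conj v₂) # (w₁ ⊗ conj w₂) = [v₁, w₁] ⊗ conj [v₂, w₂]`. -/
theorem sharpForm_tensorForm (v₁ v₂ w₁ w₂ : L) :
    sharpForm (tensorForm v₁ v₂) (tensorForm w₁ w₂) = tensorForm ⁅v₁, w₁⁆ ⁅v₂, w₂⁆ := by
  have key : ∀ (v w : L) (ξ : Module.Dual ℂ L), ξ ⁅v, w⁆ =
      ∑ ε, ∑ δ, (Module.finBasis ℂ L).coord ε v * (Module.finBasis ℂ L).coord δ w *
        ξ ⁅(Module.finBasis ℂ L) ε, (Module.finBasis ℂ L) δ⁆ := by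
    intro v w ξ
    conv_lhs => rw [← (Module.finBasis ℂ L).sum_repr v, ← (Module.finBasis ℂ L).sum_repr w]
    simp only [sum_lie, lie_sum, smul_lie, lie_smul, map_sum, map_smul,
      smul_eq_mul, Module.Basis.coord_apply, Finset.mul_sum]
    rw [Finset.sum_comm]
    refine Finset.sum_congr rfl fun i _ => Finset.sum_congr rfl fun j _ => ?_
    ring
  refine LinearMap.ext fun ξ => LinearMap.ext fun η => ?_
  simp only [sharpForm, LinearMap.sum_apply, LinearMap.smul_apply, tensorForm,
    LinearMap.mk₂'ₛₗ_apply, smul_eq_mul]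
  rw [key v₁ w₁ ξ, key v₂ w₂ η]
  simp only [map_sum, map_mul]
  simp only [Finset.sum_mul]
  simp only [Finset.mul_sum]
  refine Finset.sum_congr rfl fun i _ => ?_
  rw [Finset.sum_comm]
  refine Finset.sum_congr rfl fun j _ => Finset.sum_congr rfl fun k _ =>
    Finset.sum_congr rfl fun l _ => ?_
  ring

theorem isHermitian_sharpForm {h k : SesqForm (Module.Dual ℂ L)} (hh : IsHermitian h)
    (hk : IsHermitian k) : IsHermitian (sharpForm h k) := by
  intro ξ η
  simp only [sharpForm, LinearMap.sum_apply, LinearMap.smul_apply, tensorForm,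
    LinearMap.mk₂'ₛₗ_apply, smul_eq_mul, map_sum, map_mul, Complex.conj_conj]
  rw [Finset.sum_comm]
  refine Finset.sum_congr rfl fun i _ => Finset.sum_congr rfl fun j _ => ?_
  rw [Finset.sum_comm]
  refine Finset.sum_congr rfl fun a _ => Finset.sum_congr rfl fun b _ => ?_
  rw [hh, hk]
  ring

/-- The operation `#` on `Sym^{1,1}(L)`. -/
def Sym11.sharp (h k : Sym11 L) : Sym11 L :=
  ⟨sharpForm h.1 k.1, isHermitian_sharpForm h.2 k.2⟩

/-- The square `h^# = (1/2) h # h`. -/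
def Sym11.sharpSq (h : Sym11 L) : Sym11 L :=
  ⟨(1 / 2 : ℂ) • (h.sharp h).1, fun ξ η => by
    simp only [LinearMap.smul_apply, smul_eq_mul, map_mul]
    rw [(h.sharp h).2 ξ η]
    rw [show conj (1 / 2 : ℂ) = 1 / 2 by simp [Complex.ext_iff]]⟩

/-- The half-open time interval `[0, τ)`, where `0 < τ ≤ ∞`. -/
def timeInterval (τ : EReal) : Set ℝ := {t | 0 ≤ t ∧ (t : EReal) < τ}

/-- `h : [0, τ) → Sym^{1,1}(L)` solves `∂_t h = h^#`, `h(0) = h₀`. As `Sym^{1,1}(L)` is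
finite-dimensional, the derivative may be taken after evaluation on pairs of covectors; it is
one-sided at `t = 0`. -/
structure IsSharpFlow (h₀ : Sym11 L) (τ : EReal) (h : ℝ → Sym11 L) : Prop where
  initial : h 0 = h₀
  flow : ∀ t ∈ timeInterval τ, ∀ ξ η : Module.Dual ℂ L,
    HasDerivWithinAt (fun s => (h s).1 ξ η) ((h t).sharpSq.1 ξ η) (timeInterval τ) t

end Sharp

/-! ### Inverse forms and quotient metrics -/

section Induced

variable {V W : Type*} [AddCommGroup V] [Module ℂ V] [AddCommGroup W] [Module ℂ W]

open scoped Classical in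
/-- The inverse `h⁻¹` of a nondegenerate `h ∈ Sym^{1,1}(V)`, a form on `V`. The form `h` gives the
conjugate-linear map `η ↦ h(·, η)` from `V^*` to `V^{**}`; if `ξ_w` is the covector with
`h(·, ξ_w) = w`, then `h⁻¹(v, w) = ξ_w(v) = h(ξ_w, ξ_v)`. Junk value `0` for degenerate `h`. -/
def Sym11.inv (h : Sym11 V) : SesqForm V :=
  if hb : Function.Bijective h.1.flip then
    (((LinearEquiv.ofBijective h.1.flip hb).symm : Module.Dual ℂ (Module.Dual ℂ V) →ₗ⋆[ℂ]
      Module.Dual ℂ V).comp (Module.Dual.eval ℂ V)).flip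
  else 0

/-- The `k`-orthogonal complement of the kernel of `A`. -/
def kerPerp (k : SesqForm V) (A : V →ₗ[ℂ] W) : Submodule ℂ V where
  carrier := {v | ∀ u, A u = 0 → k v u = 0}
  add_mem' := fun ha hb u hu => by simp [ha u hu, hb u hu]
  zero_mem' := fun u _ => by simp
  smul_mem' := fun c v hv u hu => by simp [hv u hu]

open scoped Classical in
/-- The form `j_*(k|_{(ker A)^⊥})` on `W`, where `j : (ker A)^⊥ → W` is the restriction of the
surjective map `A : V → W`. Junk value `0` if `j` is not an isomorphism. -/
def pushForm (k : SesqForm V) (A : V →ₗ[ℂ] W) : SesqForm W :=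
  if hb : Function.Bijective (A.domRestrict (kerPerp k A)) then
    let lift : W →ₗ[ℂ] V := (kerPerp k A).subtype.comp
      ((LinearEquiv.ofBijective (A.domRestrict (kerPerp k A)) hb).symm : W →ₗ[ℂ] kerPerp k A)
    LinearMap.mk₂'ₛₗ (RingHom.id ℂ) (starRingEnd ℂ) (fun x y => k (lift x) (lift y))
      (fun _ _ _ => by simp) (fun _ _ _ => by simp) (fun _ _ _ => by simp) (fun _ _ _ => by simp)
  else 0

end Induced

/-! ### The Hermitian curvature flow on a complex manifold -/

/-- `∂f/∂z_i` for a function on (an open subset of) `ℂⁿ`. -/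
def dz {n : ℕ} (i : Fin n) (f : (Fin n → ℂ) → ℂ) (z : Fin n → ℂ) : ℂ :=
  (1 / 2) * (fderiv ℝ f z (Pi.single i 1) - Complex.I * fderiv ℝ f z (Pi.single i Complex.I))

/-- `∂f/∂(conj z_i)` for a function on (an open subset of) `ℂⁿ`. -/
def dzbar {n : ℕ} (i : Fin n) (f : (Fin n → ℂ) → ℂ) (z : Fin n → ℂ) : ℂ :=
  (1 / 2) * (fderiv ℝ f z (Pi.single i 1) + Complex.I * fderiv ℝ f z (Pi.single i Complex.I))

section Chern

variable {n : ℕ}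

/-- The matrix-valued function of the coefficients `g_{i j̄}` of a Hermitian metric in holomorphic
coordinates: `γ z i j = g_{i j̄}(z)`. -/
abbrev CoordMetric (n : ℕ) : Type := (Fin n → ℂ) → Matrix (Fin n) (Fin n) ℂ

/-- The inverse metric `g^{i j̄}`, normalized by `∑_j g^{i j̄} g_{k j̄} = δ_{ik}`. -/
def upper (γ : CoordMetric n) (z : Fin n → ℂ) (i j : Fin n) : ℂ := (γ z)⁻¹ j i

/-- The Christoffel symbols `Γ_{ij}^k = g^{k l̄} ∂_i g_{j l̄}` of the Chern connection,
`∇_{∂_i} ∂_j = Γ_{ij}^k ∂_k` (the other mixed components vanish as `∇^{0,1} = ∂̄`). -/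
def christoffel (γ : CoordMetric n) (i j k : Fin n) (z : Fin n → ℂ) : ℂ :=
  ∑ l, upper γ z k l * dz i (fun y => γ y j l) z

/-- The Chern curvature `Ω_{i j̄ k l̄} = g(Ω(∂_i, ∂_j̄) ∂_k, ∂_l̄)`, where
`Ω(∂_i, ∂_j̄) ∂_k = (∇_i ∇_j̄ - ∇_j̄ ∇_i) ∂_k = - ∂_j̄ Γ_{ik}^p ∂_p`. -/
def chernCurvature (γ : CoordMetric n) (i j k l : Fin n) (z : Fin n → ℂ) : ℂ :=
  ∑ p, (-dzbar j (christoffel γ i k p) z) * γ z p l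

/-- The torsion `T_{ij k̄} = g(T(∂_i, ∂_j), ∂_k̄)` with `T_{ij}^p = Γ_{ij}^p - Γ_{ji}^p`. -/
def torsion (γ : CoordMetric n) (i j k : Fin n) (z : Fin n → ℂ) : ℂ :=
  ∑ p, (christoffel γ i j p z - christoffel γ j i p z) * γ z p k

/-- The torsion-twisted Chern-Ricci form
`Θ_{i j̄} = g^{m n̄} Ω_{m n̄ i j̄} + (1/2) g^{m n̄} g^{p s̄} T_{mp j̄} T_{n̄ s̄ i}`,
where `T_{n̄ s̄ i} = conj T_{n s ī}`. -/
def torsionTwistedRicci (γ : CoordMetric n) (z : Fin n → ℂ) (i j : Fin n) : ℂ :=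
  (∑ m, ∑ q, upper γ z m q * chernCurvature γ m q i j z) +
    (1 / 2) * ∑ m, ∑ q, ∑ p, ∑ s,
      upper γ z m q * upper γ z p s * torsion γ m p j z * conj (torsion γ q s i z)

end Chern

section Manifold

variable {n : ℕ} {M : Type*} [TopologicalSpace M] [ChartedSpace (Fin n → ℂ) M]

variable (n M) in
/-- A field of sesquilinear forms on the (holomorphic) tangent spaces of an `n`-dimensional complex
manifold. -/
abbrev FormField : Type _ := (x : M) → SesqForm (TangentSpace 𝓘(ℂ, Fin n → ℂ) x)

/-- The coordinate vector field `∂/∂z_i` of a holomorphic chart at the point with coordinates `z`. -/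
def coordVec (e : OpenPartialHomeomorph M (Fin n → ℂ)) (z : Fin n → ℂ) (i : Fin n) :
    TangentSpace 𝓘(ℂ, Fin n → ℂ) (e.symm z) :=
  mfderiv 𝓘(ℂ, Fin n → ℂ) 𝓘(ℂ, Fin n → ℂ) e.symm z (Pi.single i 1 : Fin n → ℂ)

/-- The coefficients `g_{i j̄} = g(∂/∂z_i, ∂/∂z_j)` in a holomorphic chart. -/
def coeffs (g : FormField n M) (e : OpenPartialHomeomorph M (Fin n → ℂ)) : CoordMetric n :=
  fun z => Matrix.of fun i j => g (e.symm z) (coordVec e z i) (coordVec e z j)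

/-- `g : [0, τ) → {Hermitian metrics on M}` is a solution of the Hermitian curvature flow
`∂_t g_{i j̄} = - Θ_{i j̄}(g(t))`, `g(0) = g₀`: a family of Hermitian metrics, smooth on
`[0, τ) × M`, which satisfies the equation in all holomorphic charts (with a one-sided
derivative at `t = 0`). -/
structure IsHCFSolution (g₀ : FormField n M) (τ : EReal) (g : ℝ → FormField n M) : Prop where
  initial : g 0 = g₀
  metric : ∀ t ∈ timeInterval τ, ∀ x : M, IsHermitianInner (g t x)
  smooth : ∀ e ∈ IsManifold.maximalAtlas 𝓘(ℂ, Fin n → ℂ) ω M, ∀ i j : Fin n,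
    ContDiffOn ℝ ∞ (fun p : ℝ × (Fin n → ℂ) => coeffs (g p.1) e p.2 i j)
      (timeInterval τ ×ˢ e.target)
  flow : ∀ t ∈ timeInterval τ, ∀ e ∈ IsManifold.maximalAtlas 𝓘(ℂ, Fin n → ℂ) ω M,
    ∀ z ∈ e.target, ∀ i j : Fin n,
      HasDerivWithinAt (fun s => coeffs (g s) e z i j)
        (-torsionTwistedRicci (coeffs (g t) e) z i j) (timeInterval τ) t

end Manifold

/-! ### Complex homogeneous manifolds and induced metrics -/

section Homogeneous

variable {E : Type*} [NormedAddCommGroup E] [NormedSpace ℂ E]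
  {G : Type*} [TopologicalSpace G] [ChartedSpace E G] [Group G]

instance instFiniteDimensionalGroupLieAlgebra [FiniteDimensional ℂ E] :
    FiniteDimensional ℂ (GroupLieAlgebra 𝓘(ℂ, E) G) :=
  inferInstanceAs (FiniteDimensional ℂ E)

/-- The complex manifold `M` is the complex homogeneous manifold `G/H`: the complex Lie group `G`
acts on `M` holomorphically and transitively with isotropy subgroup `H` at some point `o`, and `M`
carries the complex structure of the quotient `G/H`, that is, the projection `a ↦ a • o` of `G`
onto `M ≅ G/H` is a holomorphic submersion. -/
structure IsComplexHomogeneous (E : Type*) [NormedAddCommGroup E] [NormedSpace ℂ E]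
    {G : Type*} [TopologicalSpace G] [ChartedSpace E G] [Group G] (H : Subgroup G)
    (n : ℕ) (M : Type*) [TopologicalSpace M] [ChartedSpace (Fin n → ℂ) M] [MulAction G M] :
    Prop where
  holomorphic : ContMDiff (𝓘(ℂ, E).prod 𝓘(ℂ, Fin n → ℂ)) 𝓘(ℂ, Fin n → ℂ) ω
    (fun p : G × M => p.1 • p.2)
  transitive : MulAction.IsPretransitive G M
  quotient : ∃ o : M, MulAction.stabilizer G o = H ∧
    ∀ a : G, Function.Surjective (mfderiv 𝓘(ℂ, E) 𝓘(ℂ, Fin n → ℂ) (fun b : G => b • o) a)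

variable {n : ℕ} {M : Type*} [TopologicalSpace M] [ChartedSpace (Fin n → ℂ) M] [MulAction G M]

/-- The evaluation map `ev_x : 𝔤 → T_x M`: the differential at `1` of the orbit map `a ↦ a • x`
(whose value at `1` is `1 • x = x`), so that `x ↦ ev_x(X)` is the holomorphic vector field on `M`
generated by `X ∈ 𝔤`. -/
def ev (x : M) : GroupLieAlgebra 𝓘(ℂ, E) G →ₗ[ℂ] TangentSpace 𝓘(ℂ, Fin n → ℂ) x :=
  (mfderiv 𝓘(ℂ, E) 𝓘(ℂ, Fin n → ℂ) (fun a : G => a • x) (1 : G)).toLinearMap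

/-- The field of forms `ev_* k` on `M` induced by a form `k` on `𝔤`. -/
def evPush (k : SesqForm (GroupLieAlgebra 𝓘(ℂ, E) G)) : FormField n M :=
  fun x => pushForm k (ev x)

variable (E G n M) in
/-- The set `𝓜^ind(M)` of metrics on `M` induced by Hermitian metrics on the Lie algebra of `G`. -/
def inducedMetrics : Set (FormField n M) :=
  {g | ∃ k : SesqForm (GroupLieAlgebra 𝓘(ℂ, E) G), IsHermitianInner k ∧ g = evPush k}

end Homogeneous

end HCF

end

/-! The evolution equation becomes simple on the inverse metric. By `pushForm_inv`, the quotient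
metric `ev_*(h⁻¹)` is the inverse of the image of `h` under `ev`. In a chart the metric matrix is
therefore `γ = B⁻¹`, where `B` depends linearly on `h`; so `∂_t h = h^#` gives `∂_t γ = -γ B(h^#)
γ`, and it remains to identify `γ B(h^#) γ` with `Θ`.

At a fixed time a positive `h` is a sum of squares `∑ f_μ ⊗ conj f_μ`. The inverse metric is then `∑
v_μ ⊗ conj v_μ` with `v_μ` the holomorphic fields generated by `f_μ`, that is, `B = Vᴴ V` with `V` a
holomorphic matrix. The tangent bundle is thus a metric quotient of a flat bundle. Its curvature
involves only the part of `∂V` orthogonal to the column space of `V`, its torsion only the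
antisymmetrized tangential part. `trace_projection_identity` shows that in `Θ` these two pieces
recombine into the full antisymmetrization of `v_μ^m ∂_m v_ν`, so `Θ` is half the sum of the squares
of the brackets `[v_μ, v_ν]`, lowered by `γ` (`torsionTwistedRicci_eq`). The map from `𝔤` to vector
fields reverses brackets (`lieBracket_actionField`), but each bracket occurs together with its
conjugate, so the sign disappears and the sum of squares is the image of `h^#`.

All this needs `h` to stay positive. That holds because `h^# ≥ 0` for positive `h`, so `h` does not
decrease (`IsSharpFlow.isPositive`). Part (2) adds Picard–Lindelöf for the ODE and the fact that
every Hermitian metric on `𝔤` has the form `h₀⁻¹`. -/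

open scoped Manifold ContDiff ComplexConjugate

noncomputable section

namespace HCF

/-! ### Hermitian forms, their inverses and quotient metrics -/

section LinearAlgebra

variable {V W : Type*} [AddCommGroup V] [Module ℂ V] [AddCommGroup W] [Module ℂ W]

theorem tensorForm_apply (v w : V) (ξ η : Module.Dual ℂ V) :
    tensorForm v w ξ η = ξ v * conj (η w) := rfl

theorem SesqForm.ext_basis {ι : Type*} (b : Module.Basis ι ℂ V) {k l : SesqForm V}
    (h : ∀ i j, k (b i) (b j) = l (b i) (b j)) : k = l :=
  b.ext fun i => b.ext fun j => h i j

/-- An injective conjugate-linear map between spaces of equal finite dimension is bijective. -/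
theorem bijective_of_injective_conjLinear [FiniteDimensional ℂ V] [FiniteDimensional ℂ W]
    (f : V →ₗ⋆[ℂ] W) (hd : Module.finrank ℂ V = Module.finrank ℂ W)
    (hf : Function.Injective f) : Function.Bijective f := by
  -- Conjugation fixes real scalars, so over `ℝ` the map is linear and dimensions can be counted.
  let f' : V →ₗ[ℝ] W :=
    { toFun := f
      map_add' := f.map_add
      map_smul' := fun r v => by
        have := f.map_smulₛₗ (r : ℂ) v
        rwa [Complex.conj_ofReal] at this }
  have : FiniteDimensional ℝ V := FiniteDimensional.complexToReal V
  have : FiniteDimensional ℝ W := FiniteDimensional.complexToReal W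
  have hd' : Module.finrank ℝ V = Module.finrank ℝ W := by
    rw [finrank_real_of_complex, finrank_real_of_complex, hd]
  exact ⟨hf, (LinearMap.injective_iff_surjective_of_finrank_eq_finrank (f := f') hd').1 hf⟩

theorem IsPositive.eq_zero {k : SesqForm V} (hk : IsPositive k) {v : V} (hv : k v v = 0) :
    v = 0 := by
  by_contra h
  have := hk v h
  simp [hv] at this

theorem IsPositive.flip_injective {k : SesqForm V} (hk : IsPositive k) :
    Function.Injective k.flip := by
  refine (injective_iff_map_eq_zero k.flip).2 fun v hv => hk.eq_zero ?_
  have := LinearMap.congr_fun hv v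
  simpa using this

theorem IsPositive.flip_bijective [FiniteDimensional ℂ V] {k : SesqForm V} (hk : IsPositive k) :
    Function.Bijective k.flip :=
  bijective_of_injective_conjLinear k.flip Subspace.dual_finrank_eq.symm hk.flip_injective

open scoped ComplexOrder MatrixOrder Matrix.Norms.L2Operator in
/-- A positive Hermitian element of `V ⊗ conj V` is a sum of squares. -/
theorem exists_eq_sum_tensorForm [FiniteDimensional ℂ V] (h : SesqForm (Module.Dual ℂ V))
    (hh : IsHermitian h) (hp : IsPositive h) :
    ∃ f : Fin (Module.finrank ℂ V) → V, h = ∑ μ, tensorForm (f μ) (f μ) := by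
  classical
  let b := Module.finBasis ℂ V
  let H : Matrix (Fin (Module.finrank ℂ V)) (Fin (Module.finrank ℂ V)) ℂ :=
    Matrix.of fun i j => h (b.coord i) (b.coord j)
  have hps : H.PosSemidef := by
    refine Matrix.PosSemidef.of_dotProduct_mulVec_nonneg ?_ fun x => ?_
    · ext i j
      simpa [H] using (hh (b.coord i) (b.coord j)).symm
    -- `h` is linear in its first slot, whereas `star x` stands on the left: hence the conjugated
    -- coefficients.
    · let ξ : Module.Dual ℂ V := ∑ i, conj (x i) • b.coord i
      have : star x ⬝ᵥ H.mulVec x = h ξ ξ := by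
        simp [ξ, H, dotProduct, Matrix.mulVec, Finset.mul_sum]
        rw [Finset.sum_comm]
        refine Finset.sum_congr rfl fun i _ => Finset.sum_congr rfl fun j _ => ?_
        ring
      rw [this, Complex.nonneg_iff]
      constructor
      · by_cases hξ : ξ = 0
        · simp [hξ]
        · exact (hp ξ hξ).le
      · exact (Complex.conj_eq_iff_im.1 (hh ξ ξ).symm).symm
  obtain ⟨B, hB⟩ := CStarAlgebra.nonneg_iff_eq_star_mul_self.mp hps.nonneg
  -- The factorization `H = Bᴴ B` reads `H i j = ∑ μ, conj (B μ i) * B μ j`; the conjugated rows of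
  -- `B` are the coordinates of the vectors `f μ`.
  refine ⟨fun μ => ∑ i, conj (B μ i) • b i, ?_⟩
  refine SesqForm.ext_basis b.dualBasis fun i j => ?_
  have hij := congrFun (congrFun hB i) j
  simp only [H, Matrix.of_apply, Matrix.mul_apply, Matrix.star_apply] at hij
  rw [Module.Basis.coe_dualBasis, hij]
  simp [LinearMap.sum_apply, tensorForm_apply, Finsupp.single_apply]

theorem inv_apply_eq [FiniteDimensional ℂ V] {h : Sym11 V} (hp : IsPositive h.1)
    {η : Module.Dual ℂ V} {w : V} (hη : ∀ ξ, h.1 ξ η = ξ w) (v : V) : h.inv v w = η v := by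
  unfold Sym11.inv
  rw [dif_pos hp.flip_bijective]
  have : (LinearEquiv.ofBijective h.1.flip hp.flip_bijective).symm (Module.Dual.eval ℂ V w) = η := by
    rw [LinearEquiv.symm_apply_eq]
    ext ξ
    simp [hη]
  simp [this]

theorem exists_covector [FiniteDimensional ℂ V] {h : Sym11 V} (hp : IsPositive h.1) (w : V) :
    ∃ η : Module.Dual ℂ V, ∀ ξ, h.1 ξ η = ξ w := by
  obtain ⟨η, hη⟩ := hp.flip_bijective.2 (Module.Dual.eval ℂ V w)
  exact ⟨η, fun ξ => by simpa using LinearMap.congr_fun hη ξ⟩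

theorem isHermitianInner_inv [FiniteDimensional ℂ V] {h : Sym11 V} (hp : IsPositive h.1) :
    IsHermitianInner h.inv := by
  have key : ∀ v w : V, ∀ ξ η : Module.Dual ℂ V, (∀ ζ, h.1 ζ ξ = ζ v) → (∀ ζ, h.1 ζ η = ζ w) →
      h.inv v w = h.1 η ξ := fun v w ξ η hξ hη => by rw [inv_apply_eq hp hη, hξ]
  constructor
  · intro v w
    obtain ⟨ξ, hξ⟩ := exists_covector hp v
    obtain ⟨η, hη⟩ := exists_covector hp w
    rw [key v w ξ η hξ hη, key w v η ξ hη hξ, h.2]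
  · intro v hv
    obtain ⟨ξ, hξ⟩ := exists_covector hp v
    rw [key v v ξ ξ hξ hξ]
    refine hp ξ fun h0 => hv ?_
    subst h0
    exact (Module.forall_dual_apply_eq_zero_iff ℂ v).1 fun ζ => by rw [← hξ]; simp

/-- Every Hermitian metric is the inverse of a positive definite element of `Sym^{1,1}`. -/
theorem exists_inv_eq [FiniteDimensional ℂ V] {k : SesqForm V} (hk : IsHermitianInner k) :
    ∃ h : Sym11 V, IsPositive h.1 ∧ h.inv = k := by
  let s := LinearEquiv.ofBijective k.flip hk.2.flip_bijective
  have hs : ∀ (ξ : Module.Dual ℂ V) (v : V), k v (s.symm ξ) = ξ v := fun ξ v => by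
    have : s (s.symm ξ) = ξ := s.apply_symm_apply ξ
    exact LinearMap.congr_fun this v
  let h : SesqForm (Module.Dual ℂ V) :=
    LinearMap.mk₂'ₛₗ (RingHom.id ℂ) (starRingEnd ℂ) (fun ξ η => ξ (s.symm η))
      (fun _ _ _ => by simp) (fun _ _ _ => by simp) (fun _ _ _ => by simp)
      (fun _ _ _ => by simp [LinearEquiv.map_smulₛₗ])
  have hh : ∀ ξ η, h ξ η = k (s.symm η) (s.symm ξ) := fun ξ η => (hs ξ (s.symm η)).symm
  have hp : IsPositive h := fun ξ hξ => by
    rw [hh]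
    exact hk.2 _ (by simpa using hξ)
  let h' : Sym11 V := ⟨h, fun ξ η => by rw [hh, hh]; exact hk.1 _ _⟩
  refine ⟨h', hp, ?_⟩
  ext v w
  change h'.inv v w = k v w
  rw [inv_apply_eq (h := h') (η := s w) hp (fun ξ => ?_) v]
  · rfl
  · change ξ (s.symm (s w)) = _
    simp

/-- In a basis, `h⁻¹` is given by the (transposed) inverse matrix. -/
theorem sum_mul_inv_eq [FiniteDimensional ℂ V] {h : Sym11 V} (hp : IsPositive h.1)
    {ι : Type*} [Fintype ι] [DecidableEq ι] (b : Module.Basis ι ℂ V) (i l : ι) :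
    ∑ j, h.1 (b.coord i) (b.coord j) * h.inv (b l) (b j) = if i = l then 1 else 0 := by
  obtain ⟨η, hη⟩ := exists_covector hp (b l)
  have h1 : ∀ j, h.inv (b l) (b j) = conj (η (b j)) := fun j => by
    rw [(isHermitianInner_inv hp).1, inv_apply_eq hp hη]
  have h2 : η = ∑ j, η (b j) • b.coord j := b.ext fun m => by
    simp
  have h3 := hη (b.coord i)
  rw [h2] at h3
  simp only [map_sum, LinearMap.map_smulₛₗ, smul_eq_mul] at h3
  simp only [h1]
  simp_rw [mul_comm (h.1 _ _)]
  rw [h3]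
  simp [Finsupp.single_apply, eq_comm]

/-- The image of `h ∈ Sym^{1,1}(V)` under a linear map `V → W`. -/
def Sym11.map (h : Sym11 V) (A : V →ₗ[ℂ] W) : Sym11 W :=
  ⟨LinearMap.mk₂'ₛₗ (RingHom.id ℂ) (starRingEnd ℂ) (fun ξ η => h.1 (ξ.comp A) (η.comp A))
      (fun _ _ _ => by simp [LinearMap.add_comp]) (fun _ _ _ => by simp [LinearMap.smul_comp])
      (fun _ _ _ => by simp [LinearMap.add_comp]) (fun _ _ _ => by simp [LinearMap.smul_comp]),
    fun _ _ => h.2 _ _⟩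

theorem Sym11.map_apply (h : Sym11 V) (A : V →ₗ[ℂ] W) (ξ η : Module.Dual ℂ W) :
    (h.map A).1 ξ η = h.1 (ξ.comp A) (η.comp A) := rfl

theorem Sym11.isPositive_map {h : Sym11 V} (hp : IsPositive h.1) {A : V →ₗ[ℂ] W}
    (hA : Function.Surjective A) : IsPositive (h.map A).1 := fun ξ hξ => by
  refine hp _ fun h0 => hξ (LinearMap.ext fun w => ?_)
  obtain ⟨v, rfl⟩ := hA w
  exact LinearMap.congr_fun h0 v

/-- The covector `ζ ∘ A` vanishes on `ker A`, so the vector that `h` assigns to it is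
`h⁻¹`-orthogonal to the kernel: it is the horizontal lift of `w`. The last clause computes the inner
products with this lift. -/
theorem exists_lift [FiniteDimensional ℂ V] [FiniteDimensional ℂ W] {h : Sym11 V}
    (hp : IsPositive h.1) {A : V →ₗ[ℂ] W} {ζ : Module.Dual ℂ W}
    {w : W} (hζ : ∀ ξ, (h.map A).1 ξ ζ = ξ w) :
    ∃ v ∈ kerPerp h.inv A, A v = w ∧ ∀ u, h.inv u v = ζ (A u) := by
  have hk := isHermitianInner_inv hp
  obtain ⟨v, hv⟩ : ∃ v : V, ∀ ξ, h.1 ξ (ζ.comp A) = ξ v := by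
    obtain ⟨v, hv⟩ := (Module.evalEquiv ℂ V).surjective (h.1.flip (ζ.comp A))
    exact ⟨v, fun ξ => by simpa using (LinearMap.congr_fun hv ξ).symm⟩
  have hv' : ∀ u, h.inv u v = ζ (A u) := fun u => by rw [inv_apply_eq hp hv]; rfl
  refine ⟨v, fun u hu => ?_, ?_, hv'⟩
  · rw [hk.1, hv', hu]; simp
  · refine sub_eq_zero.1 ((Module.forall_dual_apply_eq_zero_iff ℂ (A v - w)).1 fun ξ => ?_)
    have := hζ ξ
    rw [Sym11.map_apply, hv] at this
    simpa [sub_eq_zero] using this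

/-- The quotient metric of `h⁻¹` is the inverse of the image of `h`. -/
theorem pushForm_inv [FiniteDimensional ℂ V] [FiniteDimensional ℂ W] {h : Sym11 V}
    (hp : IsPositive h.1) {A : V →ₗ[ℂ] W} (hA : Function.Surjective A) :
    pushForm h.inv A = (h.map A).inv := by
  have hk := isHermitianInner_inv hp
  have hp' := Sym11.isPositive_map hp hA
  -- A vector of the complement that `A` kills is orthogonal to itself.
  have hinj : Function.Injective (A.domRestrict (kerPerp h.inv A)) := by
    refine (injective_iff_map_eq_zero _).2 fun v hv => Subtype.ext ?_
    exact hk.2.eq_zero (v.2 v.1 hv)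
  have hb : Function.Bijective (A.domRestrict (kerPerp h.inv A)) := by
    refine ⟨hinj, fun w => ?_⟩
    obtain ⟨ζ, hζ⟩ := exists_covector hp' w
    obtain ⟨v, hv, hvw, -⟩ := exists_lift hp hζ
    exact ⟨⟨v, hv⟩, hvw⟩
  unfold pushForm
  rw [dif_pos hb]
  ext x y
  obtain ⟨ζ, hζ⟩ := exists_covector hp' x
  obtain ⟨ζ', hζ'⟩ := exists_covector hp' y
  obtain ⟨v, hv, hvw, -⟩ := exists_lift hp hζ
  obtain ⟨v', hv', hvw', hu⟩ := exists_lift hp hζ'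
  have e1 : (LinearEquiv.ofBijective _ hb).symm x = ⟨v, hv⟩ := by
    rw [LinearEquiv.symm_apply_eq]; exact hvw.symm
  have e2 : (LinearEquiv.ofBijective _ hb).symm y = ⟨v', hv'⟩ := by
    rw [LinearEquiv.symm_apply_eq]; exact hvw'.symm
  rw [inv_apply_eq hp' hζ']
  simp [e1, e2, hu, hvw]

end LinearAlgebra

/-! ### The square `h^#` of a sum of squares -/

section SharpAlgebra

variable {L : Type*} [LieRing L] [LieAlgebra ℂ L] [FiniteDimensional ℂ L]

theorem sharpForm_sum_sum {ι κ : Type*} (s : Finset ι) (t : Finset κ)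
    (h : ι → SesqForm (Module.Dual ℂ L)) (k : κ → SesqForm (Module.Dual ℂ L)) :
    sharpForm (∑ i ∈ s, h i) (∑ j ∈ t, k j) = ∑ i ∈ s, ∑ j ∈ t, sharpForm (h i) (k j) := by
  let F : SesqForm (Module.Dual ℂ L) →+ SesqForm (Module.Dual ℂ L) →+ SesqForm (Module.Dual ℂ L) :=
    AddMonoidHom.mk' (fun h => AddMonoidHom.mk' (fun k => sharpForm h k) fun k k' => by
      simp [sharpForm, mul_add, add_smul, Finset.sum_add_distrib]) fun h h' => by
      ext1 k
      simp [sharpForm, add_mul, add_smul, Finset.sum_add_distrib]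
  have : ∀ h k, sharpForm h k = F h k := fun _ _ => rfl
  simp only [this, map_sum, AddMonoidHom.finsetSum_apply]
  exact Finset.sum_comm

theorem sharpSq_eq_sum {ι : Type*} [Fintype ι] {h : Sym11 L} {f : ι → L}
    (hf : h.1 = ∑ μ, tensorForm (f μ) (f μ)) :
    h.sharpSq.1 = (1 / 2 : ℂ) • ∑ μ, ∑ ν, tensorForm ⁅f μ, f ν⁆ ⁅f μ, f ν⁆ := by
  change (1 / 2 : ℂ) • sharpForm h.1 h.1 = _
  rw [hf, sharpForm_sum_sum]
  simp only [sharpForm_tensorForm]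

/-- With `h` a sum of squares of vectors `f μ`, the value is half the sum of `|ξ([f μ, f ν])|²`. -/
theorem sharpSq_nonneg {h : Sym11 L} (hp : IsPositive h.1) (ξ : Module.Dual ℂ L) :
    0 ≤ (h.sharpSq.1 ξ ξ).re := by
  obtain ⟨f, hf⟩ := exists_eq_sum_tensorForm h.1 h.2 hp
  rw [sharpSq_eq_sum hf]
  simp only [LinearMap.smul_apply, LinearMap.sum_apply, tensorForm_apply, Complex.mul_conj]
  rw [show (1 / 2 : ℂ) = ((1 / 2 : ℝ) : ℂ) by norm_num, smul_eq_mul, Complex.re_ofReal_mul]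
  refine mul_nonneg (by norm_num) ?_
  simp only [Complex.re_sum, Complex.ofReal_re]
  exact Finset.sum_nonneg fun _ _ => Finset.sum_nonneg fun _ _ => Complex.normSq_nonneg _

end SharpAlgebra

/-! ### The time interval -/

section TimeInterval

theorem convex_timeInterval (τ : EReal) : Convex ℝ (timeInterval τ) := by
  refine Set.OrdConnected.convex ⟨fun x hx y hy z hz => ⟨hx.1.trans hz.1, ?_⟩⟩
  exact lt_of_le_of_lt (EReal.coe_le_coe_iff.2 hz.2) hy.2

theorem uniqueDiffOn_timeInterval {τ : EReal} (hτ : 0 < τ) :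
    UniqueDiffOn ℝ (timeInterval τ) := by
  obtain ⟨r, hr0, hrτ⟩ := EReal.lt_iff_exists_real_btwn.1 hτ
  have hr : 0 < r := by exact_mod_cast hr0
  refine uniqueDiffOn_convex (convex_timeInterval τ) ⟨r / 2, ?_⟩
  refine mem_interior.2 ⟨Set.Ioo 0 r, fun x hx => ⟨hx.1.le, ?_⟩, isOpen_Ioo, by
    constructor <;> linarith⟩
  exact (EReal.coe_lt_coe_iff.2 hx.2).trans hrτ

theorem timeInterval_coe (ε : ℝ) : timeInterval ε = Set.Ico 0 ε := by
  ext t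
  simp [timeInterval]

end TimeInterval

/-! ### Openness of positivity -/

section Positivity

variable {V : Type*} [AddCommGroup V] [Module ℂ V]

theorem form_apply_eq_sum {ι : Type*} [Fintype ι] (b : Module.Basis ι ℂ V)
    (h : SesqForm (Module.Dual ℂ V)) (ξ η : Module.Dual ℂ V) :
    h ξ η = ∑ i, ∑ j, h (b.coord i) (b.coord j) * (ξ (b i) * conj (η (b j))) := by
  have key : ∀ ζ : Module.Dual ℂ V, ζ = ∑ j, ζ (b j) • b.coord j := fun ζ => b.ext fun m => by
    simp
  conv_lhs => rw [key ξ, key η]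
  simp only [map_sum, LinearMap.sum_apply, map_smul, LinearMap.smul_apply, LinearMap.map_smulₛₗ,
    smul_eq_mul, Finset.mul_sum]
  rw [Finset.sum_comm]
  refine Finset.sum_congr rfl fun i _ => Finset.sum_congr rfl fun j _ => ?_
  ring

open Filter Topology in
/-- Positivity is an open condition. -/
theorem eventually_isPositive [FiniteDimensional ℂ V] {X : Type*} {l : Filter X}
    {h : X → SesqForm (Module.Dual ℂ V)}
    {k : SesqForm (Module.Dual ℂ V)} (hk : IsPositive k)
    (hh : ∀ ξ η, Tendsto (fun x => h x ξ η) l (𝓝 (k ξ η))) : ∀ᶠ x in l, IsPositive (h x) := by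
  let b := Module.finBasis ℂ V
  let N := Module.finrank ℂ V
  let Q : (Fin N → Fin N → ℂ) → (Fin N → ℂ) → ℝ :=
    fun A c => (∑ i, ∑ j, A i j * (c i * conj (c j))).re
  let mat : SesqForm (Module.Dual ℂ V) → Fin N → Fin N → ℂ :=
    fun k i j => k (b.coord i) (b.coord j)
  have hQ : Continuous fun p : (Fin N → Fin N → ℂ) × (Fin N → ℂ) => Q p.1 p.2 := by
    simp only [Q]
    fun_prop
  have hmat : ∀ k ξ, (k ξ ξ).re = Q (mat k) (fun i => ξ (b i)) := fun k ξ => by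
    rw [form_apply_eq_sum b k]
  -- By homogeneity of degree 2 positivity is decided on the unit sphere, whose compactness makes
  -- the strict inequality stable under small changes of the matrix.
  have hpos : ∀ k, IsPositive k ↔ ∀ c ∈ Metric.sphere (0 : Fin N → ℂ) 1, 0 < Q (mat k) c := by
    intro k
    constructor
    · intro hk c hc
      have hbc : ∀ i, (∑ j, c j • b.coord j) (b i) = c i := fun i => by
        simp [Finsupp.single_apply]
      have := hk (∑ j, c j • b.coord j) fun h0 => by
        have : c = 0 := funext fun i => by rw [← hbc, h0]; rfl
        simp [this] at hc
      rw [hmat] at this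
      simpa only [hbc] using this
    · intro hc ξ hξ
      let c : Fin N → ℂ := fun i => ξ (b i)
      have hc0 : c ≠ 0 := fun h0 => hξ (b.ext fun i => congrFun h0 i)
      have hn : 0 < ‖c‖ := norm_pos_iff.2 hc0
      have hsc : c = ((‖c‖ : ℝ) : ℂ) • (((‖c‖⁻¹ : ℝ) : ℂ) • c) := by
        rw [smul_smul, ← Complex.ofReal_mul, mul_inv_cancel₀ hn.ne']
        simp
      have h1 := hc (((‖c‖⁻¹ : ℝ) : ℂ) • c) (by
        rw [mem_sphere_zero_iff_norm, norm_smul, Complex.norm_real, norm_inv, norm_norm,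
          inv_mul_cancel₀ hn.ne'])
      rw [hmat]
      change 0 < Q (mat k) c
      rw [hsc]
      have h2 : ∀ (r : ℝ) (d : Fin N → ℂ), Q (mat k) ((r : ℂ) • d) = r ^ 2 * Q (mat k) d := by
        intro r d
        simp only [Q]
        rw [← Complex.re_ofReal_mul]
        congr 1
        push_cast
        simp only [Finset.mul_sum]
        refine Finset.sum_congr rfl fun i _ => Finset.sum_congr rfl fun j _ => ?_
        simp
        ring
      rw [h2]
      positivity
  have hev : ∀ᶠ A in 𝓝 (mat k), ∀ c ∈ Metric.sphere (0 : Fin N → ℂ) 1, 0 < Q A c := by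
    refine (isCompact_sphere _ _).eventually_forall_of_forall_eventually fun c hc => ?_
    exact hQ.continuousAt.eventually (lt_mem_nhds ((hpos k).1 hk c hc))
  have ht : Tendsto (fun x => mat (h x)) l (𝓝 (mat k)) :=
    tendsto_pi_nhds.2 fun i => tendsto_pi_nhds.2 fun j => hh _ _
  exact (ht.eventually hev).mono fun x hx => (hpos _).2 hx

end Positivity

/-! ### The ODE `∂_t h = h^#`: regularity, positivity, short-time existence -/

section Flow

variable {L : Type*} [LieRing L] [LieAlgebra ℂ L] [FiniteDimensional ℂ L]

theorem sharpSq_apply (h : Sym11 L) (ξ η : Module.Dual ℂ L) :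
    h.sharpSq.1 ξ η = (1 / 2) * ∑ ε, ∑ γ, ∑ δ, ∑ θ,
      h.1 ((Module.finBasis ℂ L).coord ε) ((Module.finBasis ℂ L).coord γ) *
      h.1 ((Module.finBasis ℂ L).coord δ) ((Module.finBasis ℂ L).coord θ) *
      tensorForm ⁅Module.finBasis ℂ L ε, Module.finBasis ℂ L δ⁆
        ⁅Module.finBasis ℂ L γ, Module.finBasis ℂ L θ⁆ ξ η := by
  simp [Sym11.sharpSq, Sym11.sharp, sharpForm, LinearMap.sum_apply]

/-- Bootstrapping: the right-hand side is polynomial in the entries of `h`, so it is as regular as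
`h`, and `h` gains one derivative. -/
theorem IsSharpFlow.contDiffOn {h₀ : Sym11 L} {τ : EReal} (hτ : 0 < τ) {h : ℝ → Sym11 L}
    (H : IsSharpFlow h₀ τ h) (ξ η : Module.Dual ℂ L) :
    ContDiffOn ℝ ∞ (fun s => (h s).1 ξ η) (timeInterval τ) := by
  have hu := uniqueDiffOn_timeInterval hτ
  suffices ∀ n : ℕ, ∀ ξ η : Module.Dual ℂ L,
      ContDiffOn ℝ n (fun s => (h s).1 ξ η) (timeInterval τ) from
    contDiffOn_infty.2 fun n => this n ξ η
  intro n
  induction n with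
  | zero =>
    intro ξ η
    exact contDiffOn_zero.2 fun t ht => (H.flow t ht ξ η).continuousWithinAt
  | succ n ih =>
    intro ξ η
    push_cast
    refine (contDiffOn_succ_iff_derivWithin hu).2
      ⟨fun t ht => (H.flow t ht ξ η).differentiableWithinAt, by simp, ?_⟩
    refine ContDiffOn.congr (f := fun t => (h t).sharpSq.1 ξ η) ?_ fun t ht =>
      (H.flow t ht ξ η).derivWithin (hu t ht)
    simp only [sharpSq_apply]
    refine contDiffOn_const.mul ?_
    refine ContDiffOn.sum fun _ _ => ContDiffOn.sum fun _ _ => ContDiffOn.sum fun _ _ =>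
      ContDiffOn.sum fun _ _ => ?_
    exact ((ih _ _).mul (ih _ _)).mul contDiffOn_const

open Filter Topology in
/-- The flow `∂_t h = h^#` preserves positivity. -/
theorem IsSharpFlow.isPositive {h₀ : Sym11 L} (hp : IsPositive h₀.1) {τ : EReal}
    {h : ℝ → Sym11 L} (H : IsSharpFlow h₀ τ h) {t : ℝ} (ht : t ∈ timeInterval τ) :
    IsPositive (h t).1 := by
  have h0 : (0 : ℝ) ∈ timeInterval τ := ⟨le_rfl, lt_of_le_of_lt (by exact_mod_cast ht.1) ht.2⟩
  have hsub : Set.Icc 0 t ⊆ timeInterval τ := (convex_timeInterval τ).ordConnected.out h0 ht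
  have hcont : ∀ ξ : Module.Dual ℂ L,
      ContinuousOn (fun s => ((h s).1 ξ ξ).re) (timeInterval τ) := fun ξ s hs =>
    Complex.continuous_re.continuousAt.comp_continuousWithinAt (H.flow s hs ξ ξ).continuousWithinAt
  -- Positivity is an open condition but not a closed one. The bound `h ≥ h₀` is closed and implies
  -- positivity, so the continuity argument runs on it.
  let S : Set ℝ := {s | ∀ ξ : Module.Dual ℂ L, (h₀.1 ξ ξ).re ≤ ((h s).1 ξ ξ).re}
  have hS : Set.Icc 0 t ⊆ S := by
    refine IsClosed.Icc_subset_of_forall_mem_nhdsWithin ?_ ?_ ?_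
    · have : S ∩ Set.Icc 0 t =
          Set.Icc 0 t ∩ ⋂ ξ : Module.Dual ℂ L,
            {s ∈ Set.Icc 0 t | (h₀.1 ξ ξ).re ≤ ((h s).1 ξ ξ).re} := by
        ext s
        simp only [S, Set.mem_inter_iff, Set.mem_ofPred_eq, Set.mem_iInter]
        exact ⟨fun hs => ⟨hs.2, fun ξ => ⟨hs.2, hs.1 ξ⟩⟩, fun hs => ⟨fun ξ => (hs.2 ξ).2, hs.1⟩⟩
      rw [this]
      refine isClosed_Icc.inter (isClosed_iInter fun ξ => ?_)
      exact ContinuousOn.preimage_isClosed_of_isClosed ((hcont ξ).mono hsub) isClosed_Icc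
        isClosed_Ici
    · intro ξ
      rw [H.initial]
    -- Just after `x` the form is still positive, so its derivative `h^#` is nonnegative there and
    -- the bound persists.
    · rintro x ⟨hxS, hx⟩
      have hxI : x ∈ timeInterval τ := hsub ⟨hx.1, hx.2.le⟩
      have hxp : IsPositive (h x).1 := fun ξ hξ => (hp ξ hξ).trans_le (hxS ξ)
      have hev : ∀ᶠ y in 𝓝[timeInterval τ] x, IsPositive (h y).1 :=
        eventually_isPositive hxp fun ξ η => (H.flow x hxI ξ η).continuousWithinAt
      obtain ⟨δ, hδ, hball⟩ := Metric.mem_nhdsWithin_iff.1 hev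
      have hmem : Set.Ioo x (min t (x + δ)) ∈ 𝓝[>] x :=
        Ioo_mem_nhdsGT (lt_min hx.2 (by linarith))
      filter_upwards [hmem] with y hy ξ
      have hyt : y < t := hy.2.trans_le (min_le_left _ _)
      have hyδ : y < x + δ := hy.2.trans_le (min_le_right _ _)
      have hIcc : Set.Icc x y ⊆ timeInterval τ :=
        fun z hz => hsub ⟨hx.1.trans hz.1, hz.2.trans hyt.le⟩
      have hmono : MonotoneOn (fun s => ((h s).1 ξ ξ).re) (Set.Icc x y) := by
        refine monotoneOn_of_hasDerivWithinAt_nonneg (convex_Icc x y) ((hcont ξ).mono hIcc)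
          (f' := fun z => ((h z).sharpSq.1 ξ ξ).re) (fun z hz => ?_) fun z hz => ?_
        · have := (H.flow z (hIcc (interior_subset hz)) ξ ξ).mono (interior_subset.trans hIcc)
          exact Complex.reCLM.hasFDerivAt.comp_hasDerivWithinAt z this
        · have hz' := interior_subset hz
          refine sharpSq_nonneg (hball ⟨?_, hIcc hz'⟩) ξ
          rw [Metric.mem_ball, Real.dist_eq, abs_lt]
          constructor <;> linarith [hz'.1, hz'.2]
      exact (hxS ξ).trans (hmono ⟨le_rfl, hy.1.le⟩ ⟨hy.1.le, le_rfl⟩ hy.1.le)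
  exact fun ξ hξ => (hp ξ hξ).trans_le (hS ⟨ht.1, le_rfl⟩ ξ)

/-- The Hermitian part of the form with a given matrix. -/
def Sym11.ofMatrix (A : Fin (Module.finrank ℂ L) → Fin (Module.finrank ℂ L) → ℂ) : Sym11 L :=
  ⟨∑ i, ∑ j, ((1 / 2) * (A i j + conj (A j i))) •
      tensorForm (Module.finBasis ℂ L i) (Module.finBasis ℂ L j), fun ξ η => by
    have h2 : conj (1 / 2 : ℂ) = 1 / 2 := by simp [Complex.ext_iff]
    simp only [LinearMap.sum_apply, LinearMap.smul_apply, tensorForm_apply, smul_eq_mul, map_sum,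
      map_mul, map_add, Complex.conj_conj, h2]
    rw [Finset.sum_comm]
    refine Finset.sum_congr rfl fun i _ => Finset.sum_congr rfl fun j _ => ?_
    ring⟩

theorem Sym11.ofMatrix_apply (A : Fin (Module.finrank ℂ L) → Fin (Module.finrank ℂ L) → ℂ)
    (ξ η : Module.Dual ℂ L) : (Sym11.ofMatrix A).1 ξ η = ∑ i, ∑ j,
      (1 / 2) * (A i j + conj (A j i)) *
        (ξ (Module.finBasis ℂ L i) * conj (η (Module.finBasis ℂ L j))) := by
  simp [Sym11.ofMatrix, LinearMap.sum_apply, tensorForm_apply]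

/-- Short-time existence for the flow `∂_t h = h^#`. -/
theorem exists_isSharpFlow (h₀ : Sym11 L) :
    ∃ ε : ℝ, 0 < ε ∧ ∃ h : ℝ → Sym11 L, IsSharpFlow h₀ ε h := by
  let b := Module.finBasis ℂ L
  let N := Module.finrank ℂ L
  -- Passing to the Hermitian part defines the vector field on all matrices, with Hermitian values.
  let F : (Fin N → Fin N → ℂ) → Fin N → Fin N → ℂ :=
    fun A i j => (Sym11.ofMatrix A).sharpSq.1 (b.coord i) (b.coord j)
  have hF : ContDiff ℝ 1 F := by
    refine contDiff_pi.2 fun i => contDiff_pi.2 fun j => ?_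
    simp only [F, sharpSq_apply, Sym11.ofMatrix_apply]
    have hA : ∀ i j, ContDiff ℝ 1 fun A : Fin N → Fin N → ℂ => A i j := fun i j =>
      contDiff_apply_apply ℝ ℂ i j
    have hA' : ∀ i j, ContDiff ℝ 1 fun A : Fin N → Fin N → ℂ => conj (A i j) := fun i j =>
      Complex.conjCLE.contDiff.comp (hA i j)
    have hS : ∀ ξ η : Module.Dual ℂ L, ContDiff ℝ 1 fun A : Fin N → Fin N → ℂ => ∑ i, ∑ j,
      (1 / 2) * (A i j + conj (A j i)) * (ξ (b i) * conj (η (b j))) := fun ξ η =>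
      ContDiff.sum fun i _ => ContDiff.sum fun j _ =>
        (contDiff_const.mul ((hA i j).add (hA' j i))).mul contDiff_const
    exact contDiff_const.mul <| ContDiff.sum fun _ _ => ContDiff.sum fun _ _ =>
      ContDiff.sum fun _ _ => ContDiff.sum fun _ _ => ((hS _ _).mul (hS _ _)).mul contDiff_const
  let A₀ : Fin N → Fin N → ℂ := fun i j => h₀.1 (b.coord i) (b.coord j)
  obtain ⟨A, hA0, ε, hε, hA⟩ :=
    hF.contDiffAt.exists_forall_mem_closedBall_exists_eq_forall_mem_Ioo_hasDerivAt₀ (x₀ := A₀) 0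
  refine ⟨ε, hε, fun t => Sym11.ofMatrix (A t), ?_, ?_⟩
  · rw [hA0]
    refine Subtype.ext (LinearMap.ext fun ξ => LinearMap.ext fun η => ?_)
    rw [Sym11.ofMatrix_apply, form_apply_eq_sum b h₀.1]
    refine Finset.sum_congr rfl fun i _ => Finset.sum_congr rfl fun j _ => ?_
    simp only [A₀]
    rw [← h₀.2 (b.coord i) (b.coord j)]
    ring
  · intro t ht ξ η
    rw [timeInterval_coe] at ht ⊢
    have hAt : HasDerivAt A (F (A t)) t := hA t ⟨by linarith [ht.1], by linarith [ht.2]⟩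
    have hij : ∀ i j, HasDerivAt (fun s => A s i j) (F (A t) i j) t := fun i j =>
      hasDerivAt_pi.1 (hasDerivAt_pi.1 hAt i) j
    -- As `F (A t)` is Hermitian, `A` and its conjugate transpose have the same derivative. The
    -- Hermitian part therefore solves the ODE, without a proof that `A` itself is Hermitian.
    have hij' : ∀ i j, HasDerivAt (fun s => conj (A s j i)) (F (A t) i j) t := fun i j => by
      have h1 := Complex.conjCLE.hasFDerivAt.comp_hasDerivAt t (hij j i)
      have h2 : F (A t) i j = conj (F (A t) j i) := (Sym11.ofMatrix (A t)).sharpSq.2 _ _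
      rw [h2]
      exact h1
    rw [form_apply_eq_sum b]
    simp only [Sym11.ofMatrix_apply]
    refine HasDerivAt.hasDerivWithinAt ?_
    refine HasDerivAt.fun_sum fun i _ => HasDerivAt.fun_sum fun j _ => ?_
    have := (((hij i j).add (hij' i j)).const_mul (1 / 2 : ℂ)).mul_const
      (ξ (b i) * conj (η (b j)))
    refine HasDerivAt.congr_deriv this ?_
    change _ = F (A t) i j * _
    ring

end Flow

/-! ### Smoothness and derivative of inverse matrices -/

section MatrixSmoothness

variable {X : Type*} [NormedAddCommGroup X] [NormedSpace ℝ X] {m : Type*} [Fintype m]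
  [DecidableEq m] {k : ℕ∞ω} {s : Set X}

theorem contDiffOn_det {A : X → Matrix m m ℂ} (hA : ∀ i j, ContDiffOn ℝ k (fun x => A x i j) s) :
    ContDiffOn ℝ k (fun x => (A x).det) s := by
  simp only [Matrix.det_apply']
  exact ContDiffOn.sum fun σ _ => contDiffOn_const.mul (contDiffOn_prod fun i _ => hA _ _)

/-- A smooth matrix-valued function with a one-sided inverse has a smooth inverse. -/
theorem contDiffOn_of_mul_eq_one {A B : X → Matrix m m ℂ}
    (hB : ∀ i j, ContDiffOn ℝ k (fun x => B x i j) s) (hAB : ∀ x ∈ s, A x * B x = 1) (i j : m) :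
    ContDiffOn ℝ k (fun x => A x i j) s := by
  have hdet : ∀ x ∈ s, (B x).det ≠ 0 := fun x hx h0 => by
    have := congrArg Matrix.det (hAB x hx)
    simp [h0] at this
  -- Cramer's rule: the inverse is the adjugate over the determinant, both polynomial in the entries
  -- of `B`.
  have hadj : ContDiffOn ℝ k (fun x => (B x).adjugate i j) s := by
    simp only [Matrix.adjugate_apply]
    refine contDiffOn_det fun a b => ?_
    by_cases ha : a = j
    · subst ha
      simpa using contDiffOn_const
    · simpa [Matrix.updateRow_ne ha] using hB a b
  refine ((ContDiffOn.inv (contDiffOn_det hB) hdet).mul hadj).congr fun x hx => ?_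
  rw [← Matrix.inv_eq_left_inv (hAB x hx), Matrix.inv_def]
  simp

end MatrixSmoothness

section MatrixDeriv

/-- Derivative of the inverse of a matrix-valued function. -/
theorem hasDerivWithinAt_of_mul_eq_one {m : Type*} [Fintype m] [DecidableEq m]
    {A B : ℝ → Matrix m m ℂ} {B' : Matrix m m ℂ} {s : Set ℝ} {t : ℝ} (ht : t ∈ s)
    (hu : UniqueDiffWithinAt ℝ s t)
    (hA : ∀ i j, DifferentiableWithinAt ℝ (fun x => A x i j) s t)
    (hB : ∀ i j, HasDerivWithinAt (fun x => B x i j) (B' i j) s t)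
    (hAB : ∀ x ∈ s, A x * B x = 1) (i j : m) :
    HasDerivWithinAt (fun x => A x i j) ((-(A t * B' * A t)) i j) s t := by
  let A' : Matrix m m ℂ := Matrix.of fun i j => derivWithin (fun x => A x i j) s t
  have hA' : ∀ i j, HasDerivWithinAt (fun x => A x i j) (A' i j) s t := fun i j =>
    (hA i j).hasDerivWithinAt
  -- Differentiate `A * B = 1`; one-sided derivatives are unique by `hu`.
  have hprod : A' * B t + A t * B' = 0 := by
    ext a b
    have h1 : HasDerivWithinAt (fun x => (A x * B x) a b) ((A' * B t + A t * B') a b) s t := by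
      simp only [Matrix.mul_apply, Matrix.add_apply, ← Finset.sum_add_distrib]
      exact HasDerivWithinAt.fun_sum fun c _ => (hA' a c).mul (hB c b)
    have h2 : HasDerivWithinAt (fun x => (A x * B x) a b) 0 s t :=
      (hasDerivWithinAt_const t s ((1 : Matrix m m ℂ) a b)).congr
        (fun x hx => by rw [hAB x hx]) (by rw [hAB t ht])
    exact hu.eq_deriv _ h1 h2
  have hBA : B t * A t = 1 := mul_eq_one_comm.1 (hAB t ht)
  have : A' = -(A t * B' * A t) := by
    calc A' = A' * B t * A t := by rw [Matrix.mul_assoc, hBA, Matrix.mul_one]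
      _ = -(A t * B') * A t := by rw [eq_neg_of_add_eq_zero_left hprod]
      _ = _ := by rw [Matrix.neg_mul]
  rw [← this]
  exact hA' i j

end MatrixDeriv

/-! ### Wirtinger calculus -/

section Wirtinger

variable {n : ℕ}

/-- The first-order operator `(1/2) (∂/∂x_i + c ∂/∂y_i)`. -/
def wirt (c : ℂ) (i : Fin n) (f : (Fin n → ℂ) → ℂ) (z : Fin n → ℂ) : ℂ :=
  (1 / 2) * (fderiv ℝ f z (Pi.single i 1) + c * fderiv ℝ f z (Pi.single i Complex.I))

/-- The parameter lets one set of rules serve both operators: `c = -I` gives `∂_i`, `c = I` gives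
`∂̄_i`. -/
theorem dz_eq_wirt : dz (n := n) = wirt (-Complex.I) := by
  funext i f z
  simp only [dz, wirt]
  ring

theorem dzbar_eq_wirt : dzbar (n := n) = wirt Complex.I := rfl

variable {c : ℂ} {i : Fin n} {z : Fin n → ℂ} {f g : (Fin n → ℂ) → ℂ}

theorem wirt_congr (h : f =ᶠ[nhds z] g) : wirt c i f z = wirt c i g z := by
  simp only [wirt, h.fderiv_eq]

theorem wirt_const (a : ℂ) : wirt c i (fun _ => a) z = 0 := by
  simp [wirt]

theorem wirt_neg : wirt c i (fun y => -f y) z = -wirt c i f z := by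
  simp only [wirt, fderiv_fun_neg, neg_apply]
  ring

theorem wirt_mul (hf : DifferentiableAt ℝ f z) (hg : DifferentiableAt ℝ g z) :
    wirt c i (fun y => f y * g y) z = wirt c i f z * g z + f z * wirt c i g z := by
  simp only [wirt, fderiv_fun_mul hf hg, add_apply,
    smul_apply, smul_eq_mul]
  ring

theorem wirt_sum {ι : Type*} (s : Finset ι) {F : ι → (Fin n → ℂ) → ℂ}
    (hF : ∀ a ∈ s, DifferentiableAt ℝ (F a) z) :
    wirt c i (fun y => ∑ a ∈ s, F a y) z = ∑ a ∈ s, wirt c i (F a) z := by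
  simp only [wirt, fderiv_fun_sum hF, sum_apply, Finset.mul_sum,
    ← Finset.sum_add_distrib]

/-- Cauchy–Riemann: the `y`-derivative is `I` times the `x`-derivative. The scalar factor is `1` for
`∂_i` and `0` for `∂̄_i`; for conjugates the roles are exchanged. -/
theorem wirt_of_differentiableAt (hf : DifferentiableAt ℂ f z) :
    wirt c i f z = (1 / 2) * (1 + c * Complex.I) * fderiv ℂ f z (Pi.single i 1) := by
  have h1 : fderiv ℝ f z = (fderiv ℂ f z).restrictScalars ℝ :=
    (hf.hasFDerivAt.restrictScalars ℝ).fderiv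
  have h2 : (Pi.single i Complex.I : Fin n → ℂ) = Complex.I • Pi.single i 1 := by
    ext j
    by_cases h : j = i
    · subst h; simp
    · simp [h]
  rw [wirt, h1, h2]
  simp only [ContinuousLinearMap.coe_restrictScalars', map_smul, smul_eq_mul]
  ring

theorem wirt_conj_of_differentiableAt (hf : DifferentiableAt ℂ f z) :
    wirt c i (fun y => conj (f y)) z =
      (1 / 2) * (1 - c * Complex.I) * conj (fderiv ℂ f z (Pi.single i 1)) := by
  have hr : DifferentiableAt ℝ f z := hf.restrictScalars ℝ
  have h1 : ∀ u, fderiv ℝ (fun y => conj (f y)) z u = conj (fderiv ℝ f z u) := fun u => by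
    have := (Complex.conjCLE.hasFDerivAt.comp z hr.hasFDerivAt).fderiv
    exact congrArg (fun l => l u) this
  have h2 := wirt_of_differentiableAt (c := conj c) (i := i) hf
  have h3 : wirt c i (fun y => conj (f y)) z = conj (wirt (conj c) i f z) := by
    have hhalf : conj (1 / 2 : ℂ) = 1 / 2 := by simp [Complex.ext_iff]
    simp only [wirt, h1, map_mul, map_add, Complex.conj_conj, hhalf]
  rw [h3, h2]
  have hhalf : conj (1 / 2 : ℂ) = 1 / 2 := by simp [Complex.ext_iff]
  simp only [map_mul, map_add, Complex.conj_conj, Complex.conj_I, map_one, hhalf]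
  ring

/-- Entrywise version of `wirt`. -/
def matWirt {m k : Type*} (c : ℂ) (i : Fin n) (A : (Fin n → ℂ) → Matrix m k ℂ) (z : Fin n → ℂ) :
    Matrix m k ℂ :=
  Matrix.of fun a b => wirt c i (fun y => A y a b) z

theorem matWirt_mul {m k l : Type*} [Fintype k] {A : (Fin n → ℂ) → Matrix m k ℂ}
    {B : (Fin n → ℂ) → Matrix k l ℂ} (hA : ∀ a b, DifferentiableAt ℝ (fun y => A y a b) z)
    (hB : ∀ a b, DifferentiableAt ℝ (fun y => B y a b) z) :
    matWirt c i (fun y => A y * B y) z = matWirt c i A z * B z + A z * matWirt c i B z := by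
  ext a b
  simp only [matWirt, Matrix.mul_apply, Matrix.add_apply, Matrix.of_apply]
  rw [wirt_sum _ fun d _ => (hA a d).fun_mul (hB d b), ← Finset.sum_add_distrib]
  exact Finset.sum_congr rfl fun d _ => wirt_mul (hA a d) (hB d b)

theorem matWirt_of_mul_eq_one {m : Type*} [Fintype m] [DecidableEq m]
    {A B : (Fin n → ℂ) → Matrix m m ℂ} (hA : ∀ a b, DifferentiableAt ℝ (fun y => A y a b) z)
    (hB : ∀ a b, DifferentiableAt ℝ (fun y => B y a b) z)
    (hAB : ∀ᶠ y in nhds z, A y * B y = 1) :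
    matWirt c i A z * B z = -(A z * matWirt c i B z) := by
  have h1 := matWirt_mul (c := c) (i := i) hA hB
  have h2 : matWirt c i (fun y => A y * B y) z = 0 := by
    ext a b
    simp only [matWirt, Matrix.of_apply, Matrix.zero_apply]
    rw [wirt_congr (g := fun _ => (1 : Matrix m m ℂ) a b) (hAB.mono fun y hy => by
      simp only [hy]), wirt_const]
  rw [h2] at h1
  exact eq_neg_of_add_eq_zero_left h1.symm

end Wirtinger

/-! ### Chern geometry of a metric whose inverse is a sum of squares of holomorphic fields -/

section Frame

open Matrix

/-- The Hermitian product of two matrices is `∑ A conj(B) = tr (A Bᴴ)`. -/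
theorem sum_mul_conj_eq_trace {ι : Type*} [Fintype ι] (A B : Matrix ι ι ℂ) :
    ∑ μ, ∑ ν, A μ ν * conj (B μ ν) = (A * Bᴴ).trace := by
  simp [Matrix.trace, Matrix.mul_apply]

/-- Splitting of the antisymmetrization of `E` with respect to a projector `R`. -/
theorem trace_projection_identity {ι : Type*} [Fintype ι] [DecidableEq ι] {R E E' : Matrix ι ι ℂ}
    (hR : R * R = R) (hRh : Rᴴ = R) (hE : Rᵀ * E = E) (hE' : Rᵀ * E' = E') :
    ((E - E * R) * E'ᴴ).trace +
        (1 / 2) * ((E * R - (E * R)ᵀ) * (E' * R - (E' * R)ᵀ)ᴴ).trace =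
      (1 / 2) * ((E - Eᵀ) * (E' - E'ᵀ)ᴴ).trace := by
  have hRT : Rᵀᴴ = Rᵀ := congrArg Matrix.transpose hRh
  have e1 : ∀ A B : Matrix ι ι ℂ, (Aᵀ * Bᵀᴴ).trace = (A * Bᴴ).trace := fun A B => by
    rw [← Matrix.trace_transpose, Matrix.transpose_mul, Matrix.transpose_transpose,
      Matrix.trace_mul_comm]
    rfl
  have e2 : ∀ A B : Matrix ι ι ℂ, (Aᵀ * Bᴴ).trace = (A * Bᵀᴴ).trace := fun A B => by
    rw [← e1 A Bᵀ, Matrix.transpose_transpose]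
  have e3 : (E * R * (E' * R)ᴴ).trace = (E * R * E'ᴴ).trace := by
    rw [Matrix.conjTranspose_mul, hRh, ← Matrix.mul_assoc, Matrix.mul_assoc E R R, hR]
  have e4 : (E * R * (E' * R)ᵀᴴ).trace = (E * E'ᵀᴴ).trace := by
    have h1 : R * E'ᵀᴴ = E'ᵀᴴ := by
      have := congrArg (fun M => Mᵀᴴ) hE'
      simp only [Matrix.transpose_mul, Matrix.transpose_transpose, Matrix.conjTranspose_mul,
        hRh] at this
      exact this
    rw [Matrix.transpose_mul, Matrix.conjTranspose_mul, hRT, ← Matrix.mul_assoc,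
      Matrix.trace_mul_comm, ← Matrix.mul_assoc, ← Matrix.mul_assoc, hE, Matrix.mul_assoc, h1]
  -- The curvature term lacks `tr (E R E'ᴴ)`, which by `e3` the diagonal torsion terms restore; by
  -- `e4` the mixed torsion terms do not see `R`.
  simp only [Matrix.sub_mul, Matrix.mul_sub, Matrix.conjTranspose_sub, Matrix.trace_sub, e1, e2,
    e3, e4]
  ring

variable {n : ℕ} {ι : Type*}

/-- The matrix whose rows are the values of the vector fields `v μ`. -/
def frame (v : ι → (Fin n → ℂ) → (Fin n → ℂ)) (z : Fin n → ℂ) : Matrix ι (Fin n) ℂ :=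
  Matrix.of fun μ k => v μ z k

/-- The partial derivatives `∂_i v_μ^k`. -/
def frameDeriv (v : ι → (Fin n → ℂ) → (Fin n → ℂ)) (i : Fin n) (z : Fin n → ℂ) :
    Matrix ι (Fin n) ℂ :=
  Matrix.of fun μ k => fderiv ℂ (fun y => v μ y k) z (Pi.single i 1)

variable {v : ι → (Fin n → ℂ) → (Fin n → ℂ)} {O : Set (Fin n → ℂ)} {γ : CoordMetric n}

theorem differentiableAt_frame (hO : IsOpen O) (hv : ∀ μ, ContDiffOn ℂ 2 (v μ) O) {z : Fin n → ℂ}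
    (hz : z ∈ O) (μ : ι) (k : Fin n) : DifferentiableAt ℂ (fun y => frame v y μ k) z :=
  differentiableAt_pi.1 (((hv μ).contDiffAt (hO.mem_nhds hz)).differentiableAt (by simp)) k

theorem differentiableAt_frameDeriv (hO : IsOpen O) (hv : ∀ μ, ContDiffOn ℂ 2 (v μ) O)
    {z : Fin n → ℂ} (hz : z ∈ O) (i : Fin n) (μ : ι) (k : Fin n) :
    DifferentiableAt ℂ (fun y => frameDeriv v i y μ k) z := by
  have h1 : ContDiffAt ℂ 2 (fun y => v μ y k) z :=
    contDiffAt_pi.1 ((hv μ).contDiffAt (hO.mem_nhds hz)) k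
  have h2 : ContDiffAt ℂ 1 (fderiv ℂ (fun y => v μ y k)) z :=
    h1.fderiv_right (by norm_num)
  exact (h2.differentiableAt (by simp)).clm_apply (differentiableAt_const _)

theorem matWirt_frame (hO : IsOpen O) (hv : ∀ μ, ContDiffOn ℂ 2 (v μ) O) {z : Fin n → ℂ}
    (hz : z ∈ O) (c : ℂ) (i : Fin n) :
    matWirt c i (frame v) z = ((1 / 2) * (1 + c * Complex.I)) • frameDeriv v i z := by
  ext μ k
  simp only [matWirt, Matrix.of_apply, Matrix.smul_apply, smul_eq_mul]
  exact wirt_of_differentiableAt (differentiableAt_frame hO hv hz μ k)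

theorem matWirt_frame_conjTranspose (hO : IsOpen O) (hv : ∀ μ, ContDiffOn ℂ 2 (v μ) O)
    {z : Fin n → ℂ} (hz : z ∈ O) (c : ℂ) (i : Fin n) :
    matWirt c i (fun y => (frame v y)ᴴ) z =
      ((1 / 2) * (1 - c * Complex.I)) • (frameDeriv v i z)ᴴ := by
  ext k μ
  simp only [matWirt, Matrix.of_apply, Matrix.smul_apply, smul_eq_mul,
    Matrix.conjTranspose_apply]
  exact wirt_conj_of_differentiableAt (differentiableAt_frame hO hv hz μ k)

theorem differentiableAt_conj_frame (hO : IsOpen O) (hv : ∀ μ, ContDiffOn ℂ 2 (v μ) O)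
    {z : Fin n → ℂ} (hz : z ∈ O) (k : Fin n) (μ : ι) :
    DifferentiableAt ℝ (fun y => (frame v y)ᴴ k μ) z :=
  Complex.conjCLE.differentiableAt.comp z
    ((differentiableAt_frame hO hv hz μ k).restrictScalars ℝ)

variable [Fintype ι]

theorem differentiableAt_gram (hO : IsOpen O) (hv : ∀ μ, ContDiffOn ℂ 2 (v μ) O)
    {z : Fin n → ℂ} (hz : z ∈ O) (j k : Fin n) :
    DifferentiableAt ℝ (fun y => ((frame v y)ᴴ * frame v y) j k) z := by
  simp only [Matrix.mul_apply]
  exact DifferentiableAt.fun_sum fun μ _ => (differentiableAt_conj_frame hO hv hz j μ).fun_mul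
    ((differentiableAt_frame hO hv hz μ k).restrictScalars ℝ)

theorem matWirt_gram (hO : IsOpen O) (hv : ∀ μ, ContDiffOn ℂ 2 (v μ) O)
    {z : Fin n → ℂ} (hz : z ∈ O) (c : ℂ) (i : Fin n) :
    matWirt c i (fun y => (frame v y)ᴴ * frame v y) z =
      ((1 / 2) * (1 - c * Complex.I)) • ((frameDeriv v i z)ᴴ * frame v z) +
        ((1 / 2) * (1 + c * Complex.I)) • ((frame v z)ᴴ * frameDeriv v i z) := by
  rw [matWirt_mul (fun k μ => differentiableAt_conj_frame hO hv hz k μ)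
    (fun μ k => (differentiableAt_frame hO hv hz μ k).restrictScalars ℝ),
    matWirt_frame hO hv hz, matWirt_frame_conjTranspose hO hv hz, Matrix.smul_mul, Matrix.mul_smul]

theorem differentiableAt_metric (hO : IsOpen O) (hv : ∀ μ, ContDiffOn ℂ 2 (v μ) O)
    (hγ : ∀ z ∈ O, γ z * ((frame v z)ᴴ * frame v z) = 1) {z : Fin n → ℂ} (hz : z ∈ O)
    (i j : Fin n) : DifferentiableAt ℝ (fun y => γ y i j) z := by
  have hf : ∀ μ k, ContDiffOn ℝ 1 (fun y => frame v y μ k) O := fun μ k =>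
    (((contDiffOn_pi.1 (hv μ)) k).of_le (by norm_num)).restrict_scalars ℝ
  have hB : ∀ a b, ContDiffOn ℝ 1 (fun y => ((frame v y)ᴴ * frame v y) a b) O := fun a b => by
    simp only [Matrix.mul_apply]
    exact ContDiffOn.sum fun μ _ =>
      (Complex.conjCLE.contDiff.comp_contDiffOn (hf μ a)).mul (hf μ b)
  exact ((contDiffOn_of_mul_eq_one hB hγ i j).contDiffAt (hO.mem_nhds hz)).differentiableAt
    (by simp)

theorem half_one_add_neg_I : (1 / 2 : ℂ) * (1 + -Complex.I * Complex.I) = 1 := by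
  rw [neg_mul, Complex.I_mul_I]; norm_num

theorem half_one_sub_neg_I : (1 / 2 : ℂ) * (1 - -Complex.I * Complex.I) = 0 := by
  rw [neg_mul, Complex.I_mul_I]; norm_num

theorem half_one_add_I : (1 / 2 : ℂ) * (1 + Complex.I * Complex.I) = 0 := by
  rw [Complex.I_mul_I]; norm_num

theorem half_one_sub_I : (1 / 2 : ℂ) * (1 - Complex.I * Complex.I) = 1 := by
  rw [Complex.I_mul_I]; norm_num

/-- The Christoffel symbols of the metric `(Vᴴ V)⁻¹` are `-(γ Vᴴ ∂_i V)`. -/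
theorem christoffel_eq (hO : IsOpen O) (hv : ∀ μ, ContDiffOn ℂ 2 (v μ) O)
    (hγ : ∀ z ∈ O, γ z * ((frame v z)ᴴ * frame v z) = 1) {z : Fin n → ℂ} (hz : z ∈ O)
    (i j k : Fin n) :
    christoffel γ i j k z = -(γ z * (frame v z)ᴴ * frameDeriv v i z) j k := by
  have h1 : christoffel γ i j k z =
      (matWirt (-Complex.I) i γ z * ((frame v z)ᴴ * frame v z)) j k := by
    rw [← Matrix.inv_eq_right_inv (hγ z hz), Matrix.mul_apply, christoffel, dz_eq_wirt]
    exact Finset.sum_congr rfl fun l _ => mul_comm _ _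
  rw [h1, matWirt_of_mul_eq_one (differentiableAt_metric hO hv hγ hz)
    (differentiableAt_gram hO hv hz) ((hO.eventually_mem hz).mono hγ), matWirt_gram hO hv hz,
    half_one_add_neg_I, half_one_sub_neg_I, zero_smul, zero_add, one_smul, Matrix.neg_apply,
    Matrix.mul_assoc]

/-- In `γ Vᴴ ∂_i V` the last factor is holomorphic, so `∂̄_q` acts only on `γ Vᴴ`. Differentiating
`Vᴴ` gives the `1`, differentiating `γ` the projector: the usual curvature of a quotient of a flat
bundle. -/
theorem chernCurvature_eq [DecidableEq ι] (hO : IsOpen O) (hv : ∀ μ, ContDiffOn ℂ 2 (v μ) O)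
    (hγ : ∀ z ∈ O, γ z * ((frame v z)ᴴ * frame v z) = 1) {z : Fin n → ℂ} (hz : z ∈ O)
    (i q j l : Fin n) :
    chernCurvature γ i q j l z = (γ z * (frameDeriv v q z)ᴴ *
      (1 - frame v z * γ z * (frame v z)ᴴ) * frameDeriv v i z * γ z :
        Matrix (Fin n) (Fin n) ℂ) j l := by
  have hdγ := differentiableAt_metric hO hv hγ hz
  have hdV := differentiableAt_conj_frame hO hv hz
  have hdγV : ∀ a b, DifferentiableAt ℝ (fun y => (γ y * (frame v y)ᴴ) a b) z := fun a b => by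
    simp only [Matrix.mul_apply]
    exact DifferentiableAt.fun_sum fun k _ => (hdγ a k).fun_mul (hdV k b)
  have h1 : ∀ p, -dzbar q (christoffel γ i j p) z =
      matWirt Complex.I q (fun y => γ y * (frame v y)ᴴ * frameDeriv v i y) z j p := fun p => by
    rw [dzbar_eq_wirt, wirt_congr ((hO.eventually_mem hz).mono fun y hy =>
      christoffel_eq hO hv hγ hy i j p), wirt_neg, neg_neg]
    rfl
  have h2 : matWirt Complex.I q (frameDeriv v i) z = 0 := by
    ext μ k
    simp only [matWirt, Matrix.of_apply, Matrix.zero_apply]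
    rw [wirt_of_differentiableAt (differentiableAt_frameDeriv hO hv hz i μ k), half_one_add_I,
      zero_mul]
  have h3 : matWirt Complex.I q γ z = -(γ z * ((frameDeriv v q z)ᴴ * frame v z) * γ z) := by
    have h := matWirt_of_mul_eq_one (c := Complex.I) (i := q) hdγ (differentiableAt_gram hO hv hz)
      ((hO.eventually_mem hz).mono hγ)
    rw [matWirt_gram hO hv hz, half_one_add_I, half_one_sub_I, zero_smul, add_zero, one_smul] at h
    have hBA := mul_eq_one_comm.1 (hγ z hz)
    rw [← Matrix.neg_mul, ← h, Matrix.mul_assoc, hBA, Matrix.mul_one]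
  have h4 : matWirt Complex.I q (fun y => γ y * (frame v y)ᴴ) z =
      γ z * (frameDeriv v q z)ᴴ * (1 - frame v z * γ z * (frame v z)ᴴ) := by
    rw [matWirt_mul hdγ hdV, h3, matWirt_frame_conjTranspose hO hv hz, half_one_sub_I, one_smul]
    simp only [Matrix.mul_sub, Matrix.mul_one, Matrix.neg_mul, Matrix.mul_assoc]
    abel
  have h5 : matWirt Complex.I q (fun y => γ y * (frame v y)ᴴ * frameDeriv v i y) z =
      γ z * (frameDeriv v q z)ᴴ * (1 - frame v z * γ z * (frame v z)ᴴ) * frameDeriv v i z := by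
    rw [matWirt_mul hdγV fun a b =>
      (differentiableAt_frameDeriv hO hv hz i a b).restrictScalars ℝ, h2, h4, Matrix.mul_zero,
      add_zero]
  simp only [chernCurvature, h1, h5]
  rw [← Matrix.mul_apply]

theorem torsion_eq (hO : IsOpen O) (hv : ∀ μ, ContDiffOn ℂ 2 (v μ) O)
    (hγ : ∀ z ∈ O, γ z * ((frame v z)ᴴ * frame v z) = 1) {z : Fin n → ℂ} (hz : z ∈ O)
    (i j k : Fin n) :
    torsion γ i j k z = (γ z * (frame v z)ᴴ * frameDeriv v j z * γ z) i k -
      (γ z * (frame v z)ᴴ * frameDeriv v i z * γ z) j k := by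
  simp only [torsion, christoffel_eq hO hv hγ hz]
  rw [Matrix.mul_apply (M := γ z * (frame v z)ᴴ * frameDeriv v j z),
    Matrix.mul_apply (M := γ z * (frame v z)ᴴ * frameDeriv v i z), ← Finset.sum_sub_distrib]
  exact Finset.sum_congr rfl fun p _ => by ring

theorem gram_inverse_conjTranspose {V : Matrix ι (Fin n) ℂ} {G : Matrix (Fin n) (Fin n) ℂ}
    (hG : G * (Vᴴ * V) = 1) : Gᴴ = G := by
  have h1 : Vᴴ * V * Gᴴ = 1 := by
    have := congrArg Matrix.conjTranspose hG
    simpa only [Matrix.conjTranspose_mul, Matrix.conjTranspose_conjTranspose,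
      Matrix.conjTranspose_one] using this
  calc Gᴴ = G * (Vᴴ * V) * Gᴴ := by rw [hG, Matrix.one_mul]
    _ = G := by rw [Matrix.mul_assoc, h1, Matrix.mul_one]

/-- The torsion-twisted Chern-Ricci form of the metric `γ = (Vᴴ V)⁻¹`, whose inverse is the sum of
squares of the holomorphic vector fields `v μ`, is the sum of the squares of their brackets. -/
theorem torsionTwistedRicci_eq [DecidableEq ι] (hO : IsOpen O)
    (hv : ∀ μ, ContDiffOn ℂ 2 (v μ) O)
    (hγ : ∀ z ∈ O, γ z * ((frame v z)ᴴ * frame v z) = 1) {z : Fin n → ℂ} (hz : z ∈ O)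
    {N' : Matrix (Fin n) (Fin n) ℂ}
    (hN' : ∀ j i, N' j i = (1 / 2) * ∑ μ, ∑ ν, VectorField.lieBracket ℂ (v μ) (v ν) z i *
      conj (VectorField.lieBracket ℂ (v μ) (v ν) z j)) (k l : Fin n) :
    torsionTwistedRicci γ z k l = (γ z * N' * γ z) k l := by
  set V := frame v z
  set G := γ z
  have hG : G * (Vᴴ * V) = 1 := hγ z hz
  have hGh : Gᴴ = G := gram_inverse_conjTranspose hG
  have hupper : ∀ m q, upper γ z m q = (Vᴴ * V) q m := fun m q => by
    rw [upper, Matrix.inv_eq_right_inv (hγ z hz)]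
  let W : Fin n → Matrix ι (Fin n) ℂ := fun i => frameDeriv v i z
  -- `P` is the orthogonal projector onto the column space of `V`. The entry `E j μ ν` is the
  -- derivative of `v ν` along `v μ`, lowered by the metric, so that the antisymmetrization of `E j`
  -- is a bracket.
  let P : Matrix ι ι ℂ := V * G * Vᴴ
  let F : Fin n → Matrix (Fin n) ι ℂ := fun j => Matrix.of fun m ν => (W m * G) ν j
  let E : Fin n → Matrix ι ι ℂ := fun j => V * F j
  have hPV : P * V = V := by
    simp only [P]
    rw [Matrix.mul_assoc, Matrix.mul_assoc, hG, Matrix.mul_one]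
  have hPP : P * P = P := by
    conv_lhs => enter [2]; simp only [P]
    rw [← Matrix.mul_assoc, ← Matrix.mul_assoc, hPV]
  have hPh : Pᴴ = P := by
    simp only [P, Matrix.conjTranspose_mul, Matrix.conjTranspose_conjTranspose, hGh,
      Matrix.mul_assoc]
  have hR : Pᵀ * Pᵀ = Pᵀ := by rw [← Matrix.transpose_mul, hPP]
  have hRh : Pᵀᴴ = Pᵀ := congrArg Matrix.transpose hPh
  have hE : ∀ j, Pᵀᵀ * E j = E j := fun j => by
    simp only [E]
    rw [Matrix.transpose_transpose, ← Matrix.mul_assoc, hPV]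
  have hFP : ∀ j, F j * (1 - Pᵀ) = 
      Matrix.of fun m ν => ((1 - P) * (W m * G) : Matrix ι (Fin n) ℂ) ν j := fun j => by
    ext m ν
    have : (1 - P)ᵀ = 1 - Pᵀ := by rw [Matrix.transpose_sub, Matrix.transpose_one]
    rw [← this]
    simp only [Matrix.mul_apply (M := F j), Matrix.of_apply, Matrix.transpose_apply,
      Matrix.mul_apply (M := 1 - P)]
    exact Finset.sum_congr rfl fun _ _ => mul_comm _ _
  -- Contraction with the inverse metric `Vᴴ V` is a trace; cycling moves `V` and `Vᴴ` to the
  -- outside of `F` and produces `E`.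
  have hcurv : ∑ m, ∑ q, upper γ z m q * chernCurvature γ m q k l z =
      ((E l - E l * Pᵀ) * (E k)ᴴ).trace := by
    have h1 : ∀ m q, chernCurvature γ m q k l z =
        (F l * (1 - Pᵀ) * (F k)ᴴ : Matrix (Fin n) (Fin n) ℂ) m q := fun m q => by
      have h2 : G * (W q)ᴴ = (W q * G)ᴴ := by rw [Matrix.conjTranspose_mul, hGh]
      rw [chernCurvature_eq hO hv hγ hz, hFP]
      change (G * (W q)ᴴ * (1 - P) * W m * G : Matrix (Fin n) (Fin n) ℂ) k l = _
      rw [h2, Matrix.mul_assoc _ _ G, Matrix.mul_assoc, Matrix.mul_apply, Matrix.mul_apply]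
      exact Finset.sum_congr rfl fun ν _ => mul_comm _ _
    have h3 : (E l - E l * Pᵀ) * (E k)ᴴ = V * (F l * (1 - Pᵀ) * (F k)ᴴ * Vᴴ) := by
      simp only [E, Matrix.conjTranspose_mul, Matrix.mul_sub, Matrix.sub_mul, Matrix.mul_one,
        Matrix.mul_assoc]
    rw [h3, Matrix.trace_mul_comm, Matrix.mul_assoc, Matrix.trace]
    refine Finset.sum_congr rfl fun m _ => ?_
    rw [Matrix.diag_apply, Matrix.mul_apply]
    refine Finset.sum_congr rfl fun q _ => ?_
    rw [hupper, h1, mul_comm]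
  have htors : ∑ m, ∑ q, ∑ p, ∑ s, upper γ z m q * upper γ z p s * torsion γ m p l z *
      conj (torsion γ q s k z) =
      ((E l * Pᵀ - (E l * Pᵀ)ᵀ) * (E k * Pᵀ - (E k * Pᵀ)ᵀ)ᴴ).trace := by
    let T : Fin n → Matrix (Fin n) (Fin n) ℂ := fun j => Matrix.of fun m p => torsion γ m p j z
    -- The torsion sees only the tangential part of `∂V`. The sign drops out because the torsion
    -- enters quadratically.
    have hT : ∀ j, V * T j * Vᵀ = -(E j * Pᵀ - (E j * Pᵀ)ᵀ) := fun j => by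
      have h1 : T j = (F j * (G * Vᴴ)ᵀ)ᵀ - F j * (G * Vᴴ)ᵀ := by
        have h2 : ∀ m p, (G * Vᴴ * W m * G) p j = (F j * (G * Vᴴ)ᵀ) m p := fun m p => by
          rw [Matrix.mul_assoc, Matrix.mul_apply, Matrix.mul_apply]
          exact Finset.sum_congr rfl fun ν _ => mul_comm _ _
        ext m p
        rw [Matrix.sub_apply, Matrix.transpose_apply, ← h2, ← h2]
        exact torsion_eq hO hv hγ hz m p j
      have h3 : V * (F j * (G * Vᴴ)ᵀ) * Vᵀ = E j * Pᵀ := by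
        simp only [E, P, Matrix.transpose_mul, Matrix.mul_assoc]
      have h4 : V * (F j * (G * Vᴴ)ᵀ)ᵀ * Vᵀ = (E j * Pᵀ)ᵀ := by
        rw [← h3]
        simp only [Matrix.transpose_mul, Matrix.transpose_transpose, Matrix.mul_assoc]
      rw [h1, Matrix.mul_sub, Matrix.sub_mul, h3, h4, neg_sub]
    have h5 : ((E l * Pᵀ - (E l * Pᵀ)ᵀ) * (E k * Pᵀ - (E k * Pᵀ)ᵀ)ᴴ).trace =
        (T l * (Vᴴ * V)ᵀ * (T k)ᴴ * (Vᴴ * V)).trace := by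
      have h6 : (E l * Pᵀ - (E l * Pᵀ)ᵀ) * (E k * Pᵀ - (E k * Pᵀ)ᵀ)ᴴ =
          V * T l * Vᵀ * (V * T k * Vᵀ)ᴴ := by
        rw [hT, hT, Matrix.conjTranspose_neg, neg_mul_neg]
      have h7 : (Vᴴ * V)ᵀ = Vᵀ * Vᵀᴴ := by
        rw [Matrix.transpose_mul]; rfl
      rw [h6, h7, Matrix.conjTranspose_mul, Matrix.conjTranspose_mul]
      rw [show V * T l * Vᵀ * (Vᵀᴴ * ((T k)ᴴ * Vᴴ)) = V * (T l * (Vᵀ * Vᵀᴴ) * (T k)ᴴ * Vᴴ) by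
        simp only [Matrix.mul_assoc], Matrix.trace_mul_comm, Matrix.mul_assoc _ Vᴴ V]
    rw [h5, Matrix.trace]
    refine Finset.sum_congr rfl fun m _ => ?_
    rw [Matrix.diag_apply, Matrix.mul_apply]
    refine Finset.sum_congr rfl fun q _ => ?_
    rw [Matrix.mul_apply, Finset.sum_mul, Finset.sum_comm]
    refine Finset.sum_congr rfl fun s _ => ?_
    rw [Matrix.mul_apply, Finset.sum_mul, Finset.sum_mul]
    refine Finset.sum_congr rfl fun p _ => ?_
    rw [hupper, hupper]
    simp only [T, Matrix.of_apply, Matrix.transpose_apply, Matrix.conjTranspose_apply]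
    rw [starRingEnd_apply]
    ring
  have hbr : ∀ j μ ν, (E j - (E j)ᵀ) μ ν =
      ∑ b, VectorField.lieBracket ℂ (v μ) (v ν) z b * G b j := by
    have hd : ∀ μ, DifferentiableAt ℂ (v μ) z := fun μ =>
      ((hv μ).contDiffAt (hO.mem_nhds hz)).differentiableAt (by simp)
    have h1 : ∀ μ ν b, fderiv ℂ (v ν) z (v μ z) b = ∑ m, V μ m * W m ν b := fun μ ν b => by
      have h2 : v μ z = ∑ m, v μ z m • (Pi.single m 1 : Fin n → ℂ) := by
        ext a
        simp [Pi.single_apply]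
      have h3 : ∀ u, fderiv ℂ (v ν) z u b = fderiv ℂ (fun y => v ν y b) z u := fun u => by
        rw [fderiv_apply (hd ν)]
        rfl
      rw [h2, map_sum]
      simp only [map_smul, Finset.sum_apply, Pi.smul_apply, smul_eq_mul, h3]
      rfl
    have h4 : ∀ j μ ν, E j μ ν = ∑ b, fderiv ℂ (v ν) z (v μ z) b * G b j := fun j μ ν => by
      simp only [h1, Finset.sum_mul]
      rw [Finset.sum_comm]
      simp only [E, F, Matrix.mul_apply, Matrix.of_apply, Finset.mul_sum, mul_assoc]
    intro j μ ν
    rw [Matrix.sub_apply, Matrix.transpose_apply, h4, h4, ← Finset.sum_sub_distrib]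
    exact Finset.sum_congr rfl fun b _ => by
      simp only [VectorField.lieBracket, Pi.sub_apply]
      ring
  have hconj : ∀ a b, conj (G a b) = G b a := fun a b => by
    conv_rhs => rw [← hGh]
    rfl
  rw [torsionTwistedRicci, hcurv, htors,
    trace_projection_identity hR hRh (hE l) (hE k), ← sum_mul_conj_eq_trace]
  simp only [hbr, map_sum, map_mul, hconj]
  rw [Matrix.mul_apply]
  simp only [Matrix.mul_apply, hN', Finset.sum_mul, Finset.mul_sum]
  have hcomm : ∀ f : Fin n → Fin n → ι → ι → ℂ,
      ∑ b, ∑ a, ∑ μ, ∑ ν, f b a μ ν = ∑ μ, ∑ ν, ∑ a, ∑ b, f b a μ ν := fun f => by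
    calc _ = ∑ b, ∑ μ, ∑ a, ∑ ν, f b a μ ν := Finset.sum_congr rfl fun _ _ => Finset.sum_comm
      _ = ∑ μ, ∑ b, ∑ a, ∑ ν, f b a μ ν := Finset.sum_comm
      _ = _ := Finset.sum_congr rfl fun μ _ => by
        calc _ = ∑ b, ∑ ν, ∑ a, f b a μ ν := Finset.sum_congr rfl fun _ _ => Finset.sum_comm
          _ = ∑ ν, ∑ b, ∑ a, f b a μ ν := Finset.sum_comm
          _ = _ := Finset.sum_congr rfl fun ν _ => Finset.sum_comm
  rw [hcomm]
  refine Finset.sum_congr rfl fun μ _ => Finset.sum_congr rfl fun ν _ =>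
    Finset.sum_congr rfl fun a _ => Finset.sum_congr rfl fun b _ => ?_
  ring

end Frame

/-! ### Left-invariant fields on the group -/

section LieGroupFields

variable {E : Type*} [NormedAddCommGroup E] [NormedSpace ℂ E]
  {G : Type*} [TopologicalSpace G] [ChartedSpace E G] [Group G]

theorem mdifferentiable_inv [LieGroup 𝓘(ℂ, E) ω G] :
    MDifferentiable 𝓘(ℂ, E) 𝓘(ℂ, E) (fun a : G => a⁻¹) :=
  (contMDiff_inv 𝓘(ℂ, E) ω).mdifferentiable (by simp)

theorem mdifferentiable_mul [LieGroup 𝓘(ℂ, E) ω G] :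
    MDifferentiable (𝓘(ℂ, E).prod 𝓘(ℂ, E)) 𝓘(ℂ, E) (fun p : G × G => p.1 * p.2) :=
  (contMDiff_mul 𝓘(ℂ, E) ω).mdifferentiable (by simp)

/-- The differential of the inversion at `1` is `-1`. -/
theorem mfderiv_inv_one [LieGroup 𝓘(ℂ, E) ω G] (X : GroupLieAlgebra 𝓘(ℂ, E) G) :
    (mfderiv 𝓘(ℂ, E) 𝓘(ℂ, E) (fun a : G => a⁻¹) 1 X : E) = -(X : E) := by
  -- Differentiate `a * a⁻¹ = 1`; at `(1, 1)` the differential of the multiplication is addition.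
  have h1 : mfderiv 𝓘(ℂ, E) 𝓘(ℂ, E) ((fun p : G × G => p.1 * p.2) ∘ fun a : G => (a, a⁻¹)) 1 X =
      (0 : E) := by
    have : ((fun p : G × G => p.1 * p.2) ∘ fun a : G => (a, a⁻¹)) = fun _ => (1 : G) := by
      funext a
      simp
    rw [this, mfderiv_const]
    rfl
  have hpair : MDifferentiableAt 𝓘(ℂ, E) (𝓘(ℂ, E).prod 𝓘(ℂ, E)) (fun a : G => (a, a⁻¹)) 1 :=
    mdifferentiableAt_id.prodMk mdifferentiable_inv.mdifferentiableAt
  have h2 := mfderiv_comp_apply_of_eq (1 : G) (y := ((1 : G), (1 : G)))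
    (mdifferentiable_mul (E := E)).mdifferentiableAt hpair (by simp) X
  let Y : E := mfderiv 𝓘(ℂ, E) 𝓘(ℂ, E) (fun a : G => a⁻¹) 1 X
  have h3 : mfderiv 𝓘(ℂ, E) (𝓘(ℂ, E).prod 𝓘(ℂ, E)) (fun a : G => (a, a⁻¹)) 1 X =
      ((X, Y) : E × E) := by
    have := congrArg (fun l => l X) (MDifferentiableAt.mfderiv_prod
      (mdifferentiableAt_id (I := 𝓘(ℂ, E)) (x := (1 : G)))
      (mdifferentiable_inv (E := E)).mdifferentiableAt)
    rw [mfderiv_id] at this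
    exact this
  have hid : ∀ f : G → G, f = id → ∀ u : E, (mfderiv 𝓘(ℂ, E) 𝓘(ℂ, E) f 1 u : E) = u := by
    rintro _ rfl u
    rw [mfderiv_id]
    rfl
  have h4 : ∀ u : E × E, (mfderiv (𝓘(ℂ, E).prod 𝓘(ℂ, E)) 𝓘(ℂ, E) (fun p : G × G => p.1 * p.2)
      ((1 : G), (1 : G)) u : E) = u.1 + u.2 := fun u => by
    refine (mfderiv_prod_eq_add_apply (p := ((1 : G), (1 : G))) (v := u)
      mdifferentiable_mul.mdifferentiableAt).trans ?_
    exact congrArg₂ (fun v w : E => v + w) (hid _ (funext mul_one) u.1)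
      (hid _ (funext one_mul) u.2)
  let X' : E := X
  have h5 : (0 : E) = X' + Y := by
    refine (h1.symm.trans h2).trans ?_
    refine Eq.trans ?_ (h4 (X', Y))
    exact congrArg (fun u : E × E => (mfderiv (𝓘(ℂ, E).prod 𝓘(ℂ, E)) 𝓘(ℂ, E)
      (fun p : G × G => p.1 * p.2) ((1 : G), (1 : G)) u : E)) h3
  exact eq_neg_of_add_eq_zero_right h5.symm

/-- The left-invariant vector field generated by `X`, in the coordinates at `1`. -/
def leftField (X : GroupLieAlgebra 𝓘(ℂ, E) G) : E → E :=
  VectorField.mpullbackWithin 𝓘(ℂ, E) 𝓘(ℂ, E) (extChartAt 𝓘(ℂ, E) (1 : G)).symm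
    (mulInvariantVectorField X) (Set.range 𝓘(ℂ, E))

theorem differentiableAt_leftField [CompleteSpace E] [LieGroup 𝓘(ℂ, E) ω G]
    (X : GroupLieAlgebra 𝓘(ℂ, E) G) :
    DifferentiableAt ℂ (leftField X) (extChartAt 𝓘(ℂ, E) (1 : G) 1) := by
  have : IsManifold 𝓘(ℂ, E) 2 G := IsManifold.of_le (n := ω) le_top
  have h := MDifferentiableWithinAt.differentiableWithinAt_mpullbackWithin_vectorField
    (s := Set.univ) (mdifferentiableAt_mulInvariantVectorField (g := (1 : G)) X)
  exact differentiableWithinAt_univ.1 (by simpa [leftField] using h)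

theorem leftField_apply_one [LieGroup 𝓘(ℂ, E) ω G] (X : GroupLieAlgebra 𝓘(ℂ, E) G) :
    leftField X (extChartAt 𝓘(ℂ, E) (1 : G) 1) = X := by
  have : IsManifold 𝓘(ℂ, E) 1 G := IsManifold.of_le (n := ω) le_top
  have h2 : leftField X (extChartAt 𝓘(ℂ, E) (1 : G) 1) =
    (mfderivWithin 𝓘(ℂ, E) 𝓘(ℂ, E) (extChartAt 𝓘(ℂ, E) (1 : G)).symm
    (Set.range 𝓘(ℂ, E)) (extChartAt 𝓘(ℂ, E) (1 : G) 1)).inverse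
      (mulInvariantVectorField X ((extChartAt 𝓘(ℂ, E) (1 : G)).symm
        (extChartAt 𝓘(ℂ, E) (1 : G) 1))) := rfl
  have h3 : ∀ a : G, a = 1 → (mulInvariantVectorField X a : E) = X := by
    rintro _ rfl
    have h4 : ∀ f : G → G, f = id → ∀ u : E, (mfderiv 𝓘(ℂ, E) 𝓘(ℂ, E) f 1 u : E) = u := by
      rintro _ rfl u
      rw [mfderiv_id]
      rfl
    exact h4 _ (funext one_mul) X
  exact h2.trans ((mfderivWithin_extChartAt_symm_inverse_apply (x := (1 : G)) _).trans
    (h3 _ (extChartAt_to_inv (1 : G))))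

/-- The bracket of `𝔤` is that of left-invariant fields at `1`, computed in the chart at `1`, whose
differential there is the identity. -/
theorem lieBracket_leftField [CompleteSpace E] [LieGroup 𝓘(ℂ, E) ω G]
    (X Y : GroupLieAlgebra 𝓘(ℂ, E) G) :
    VectorField.lieBracket ℂ (leftField X) (leftField Y) (extChartAt 𝓘(ℂ, E) (1 : G) 1) =
      (⁅X, Y⁆ : GroupLieAlgebra 𝓘(ℂ, E) G) := by
  have : IsManifold 𝓘(ℂ, E) 1 G := IsManifold.of_le (n := ω) le_top
  rw [GroupLieAlgebra.bracket_def, ← VectorField.mlieBracketWithin_univ,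
    VectorField.mlieBracketWithin_apply, mfderiv_extChartAt_self]
  have h1 : ∀ u : E, (ContinuousLinearMap.id ℂ E).inverse u = u := fun u => by
    rw [ContinuousLinearMap.inverse_id, ContinuousLinearMap.id_apply]
  have h2 : ∀ (S : Set E) (p : E), S = Set.univ →
      VectorField.lieBracket ℂ (leftField X) (leftField Y) p =
        VectorField.lieBracketWithin ℂ (leftField X) (leftField Y) S p := by
    rintro _ p rfl
    rw [VectorField.lieBracketWithin_univ]
  exact (h2 _ _ (by simp)).trans (h1 _).symm

theorem mfderiv_symm_leftField [LieGroup 𝓘(ℂ, E) ω G] (X : GroupLieAlgebra 𝓘(ℂ, E) G) {b : E}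
    (hb : b ∈ (extChartAt 𝓘(ℂ, E) (1 : G)).target) :
    mfderiv 𝓘(ℂ, E) 𝓘(ℂ, E) (extChartAt 𝓘(ℂ, E) (1 : G)).symm b (leftField X b : E) =
      mulInvariantVectorField X ((extChartAt 𝓘(ℂ, E) (1 : G)).symm b) := by
  have : IsManifold 𝓘(ℂ, E) 1 G := IsManifold.of_le (n := ω) le_top
  have h := isInvertible_mfderivWithin_extChartAt_symm hb
  have h2 : leftField X b = (mfderivWithin 𝓘(ℂ, E) 𝓘(ℂ, E) (extChartAt 𝓘(ℂ, E) (1 : G)).symm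
    (Set.range 𝓘(ℂ, E)) b).inverse
      (mulInvariantVectorField X ((extChartAt 𝓘(ℂ, E) (1 : G)).symm b)) := rfl
  have h3 := h.inverse_apply_eq.1 h2.symm
  rw [h3, modelWithCornersSelf_coe, Set.range_id, mfderivWithin_univ]

/-! ### Vector fields generated by the action -/

section Action

variable {n : ℕ} {M : Type*} [TopologicalSpace M] [ChartedSpace (Fin n → ℂ) M] [MulAction G M]

/-- The vector field on `M` generated by `X`, in a holomorphic chart. -/
def actionField (e : OpenPartialHomeomorph M (Fin n → ℂ)) (X : GroupLieAlgebra 𝓘(ℂ, E) G)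
    (z : Fin n → ℂ) : Fin n → ℂ :=
  mfderiv 𝓘(ℂ, E) 𝓘(ℂ, Fin n → ℂ) (fun a : G => e (a • e.symm z)) 1 X

variable {e : OpenPartialHomeomorph M (Fin n → ℂ)}

theorem mdifferentiable_orbit
    (hs : ContMDiff (𝓘(ℂ, E).prod 𝓘(ℂ, Fin n → ℂ)) 𝓘(ℂ, Fin n → ℂ) ω
      (fun p : G × M => p.1 • p.2)) (x : M) :
    MDifferentiable 𝓘(ℂ, E) 𝓘(ℂ, Fin n → ℂ) (fun a : G => a • x) :=
  (hs.comp (contMDiff_id.prodMk contMDiff_const)).mdifferentiable (by simp)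

theorem actionField_eq [IsManifold 𝓘(ℂ, Fin n → ℂ) ω M]
    (hs : ContMDiff (𝓘(ℂ, E).prod 𝓘(ℂ, Fin n → ℂ)) 𝓘(ℂ, Fin n → ℂ) ω
      (fun p : G × M => p.1 • p.2))
    (he : e ∈ IsManifold.maximalAtlas 𝓘(ℂ, Fin n → ℂ) ω M) (X : GroupLieAlgebra 𝓘(ℂ, E) G)
    {z : Fin n → ℂ} (hz : z ∈ e.target) :
    actionField e X z =
      mfderiv 𝓘(ℂ, Fin n → ℂ) 𝓘(ℂ, Fin n → ℂ) e (e.symm z) (ev (e.symm z) X) := by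
  have h1 : MDifferentiableAt 𝓘(ℂ, Fin n → ℂ) 𝓘(ℂ, Fin n → ℂ) e (e.symm z) :=
    (contMDiffAt_of_mem_maximalAtlas he (e.map_target hz)).mdifferentiableAt (by simp)
  exact mfderiv_comp_apply_of_eq (1 : G) h1 (mdifferentiable_orbit hs _).mdifferentiableAt
    (one_smul G _) X

/-- The field is a partial derivative, in the group variable at `1`, of the action map, which is
jointly holomorphic. -/
theorem contDiffOn_actionField [LieGroup 𝓘(ℂ, E) ω G] [IsManifold 𝓘(ℂ, Fin n → ℂ) ω M]
    (hs : ContMDiff (𝓘(ℂ, E).prod 𝓘(ℂ, Fin n → ℂ)) 𝓘(ℂ, Fin n → ℂ) ω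
      (fun p : G × M => p.1 • p.2))
    (he : e ∈ IsManifold.maximalAtlas 𝓘(ℂ, Fin n → ℂ) ω M) (X : GroupLieAlgebra 𝓘(ℂ, E) G) :
    ContDiffOn ℂ ∞ (actionField e X) e.target := by
  intro z hz
  refine ContDiffAt.contDiffWithinAt ?_
  let φ := extChartAt 𝓘(ℂ, E) (1 : G)
  have hφ : ContMDiffAt 𝓘(ℂ, E) 𝓘(ℂ, E) ω φ.symm (φ 1) :=
    (contMDiffOn_extChartAt_symm (1 : G)).contMDiffAt (extChartAt_target_mem_nhds (1 : G))
  have he1 : ContMDiffAt 𝓘(ℂ, Fin n → ℂ) 𝓘(ℂ, Fin n → ℂ) ω e.symm z :=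
    (contMDiffOn_symm_of_mem_maximalAtlas he).contMDiffAt (e.open_target.mem_nhds hz)
  have he2 : ContMDiffAt 𝓘(ℂ, Fin n → ℂ) 𝓘(ℂ, Fin n → ℂ) ω e (e.symm z) :=
    contMDiffAt_of_mem_maximalAtlas he (e.map_target hz)
  have hφ1 : φ.symm (φ 1) = 1 := extChartAt_to_inv (1 : G)
  let F : (Fin n → ℂ) → E → (Fin n → ℂ) := fun y b => e (φ.symm b • e.symm y)
  have hF : ContDiffAt ℂ ω (Function.uncurry F) (z, φ 1) := by
    refine ContMDiffAt.contDiffAt ?_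
    have h1 : ContMDiffAt 𝓘(ℂ, (Fin n → ℂ) × E) 𝓘(ℂ, E) ω
        (fun p : (Fin n → ℂ) × E => φ.symm p.2) (z, φ 1) :=
      ContMDiffAt.comp (z, φ 1) hφ contDiffAt_snd.contMDiffAt
    have h2 : ContMDiffAt 𝓘(ℂ, (Fin n → ℂ) × E) 𝓘(ℂ, Fin n → ℂ) ω
        (fun p : (Fin n → ℂ) × E => e.symm p.1) (z, φ 1) :=
      ContMDiffAt.comp (z, φ 1) he1 contDiffAt_fst.contMDiffAt
    have h3 := ContMDiffAt.comp (z, φ 1) hs.contMDiffAt (h1.prodMk h2)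
    refine ContMDiffAt.comp (z, φ 1) (g := e) ?_ h3
    simpa [hφ1] using he2
  have h1 : ContDiffAt ℂ ∞ (fun y => fderiv ℂ (F y) (φ 1)) z :=
    ContDiffAt.fderiv hF contDiffAt_const le_top
  have h2 : ContDiffAt ℂ ∞ (fun y => fderiv ℂ (F y) (φ 1) X) z := h1.clm_apply contDiffAt_const
  refine h2.congr_of_eventuallyEq ((e.open_target.eventually_mem hz).mono fun y hy => ?_)
  have h3 : MDifferentiableAt 𝓘(ℂ, E) 𝓘(ℂ, Fin n → ℂ) (fun a : G => e (a • e.symm y)) 1 := by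
    have h4 : MDifferentiableAt 𝓘(ℂ, Fin n → ℂ) 𝓘(ℂ, Fin n → ℂ) e ((1 : G) • e.symm y) := by
      rw [one_smul]
      exact (contMDiffAt_of_mem_maximalAtlas he (e.map_target hy)).mdifferentiableAt (by simp)
    exact h4.comp (1 : G) (mdifferentiable_orbit hs (e.symm y)).mdifferentiableAt
  rw [actionField, h3.mfderiv]
  simp only [writtenInExtChartAt, extChartAt, mfld_simps, fderivWithin_univ]
  rfl

theorem mdifferentiableAt_chart [IsManifold 𝓘(ℂ, Fin n → ℂ) ω M]
    (he : e ∈ IsManifold.maximalAtlas 𝓘(ℂ, Fin n → ℂ) ω M) {x : M} (hx : x ∈ e.source) :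
    MDifferentiableAt 𝓘(ℂ, Fin n → ℂ) 𝓘(ℂ, Fin n → ℂ) e x :=
  (contMDiffAt_of_mem_maximalAtlas he hx).mdifferentiableAt (by simp)

/-- The left-invariant vector field generated by `X` is related to the negative of the vector field
generated by `X` on `M` under the maps `a ↦ a⁻¹ • x`. -/
theorem mfderiv_inv_smul_mulInvariantVectorField [LieGroup 𝓘(ℂ, E) ω G]
    [IsManifold 𝓘(ℂ, Fin n → ℂ) ω M]
    (hs : ContMDiff (𝓘(ℂ, E).prod 𝓘(ℂ, Fin n → ℂ)) 𝓘(ℂ, Fin n → ℂ) ω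
      (fun p : G × M => p.1 • p.2))
    (he : e ∈ IsManifold.maximalAtlas 𝓘(ℂ, Fin n → ℂ) ω M) (X : GroupLieAlgebra 𝓘(ℂ, E) G)
    (x : M) (a : G) (ha : a⁻¹ • x ∈ e.source) :
    (mfderiv 𝓘(ℂ, E) 𝓘(ℂ, Fin n → ℂ) (fun c : G => e (c⁻¹ • x)) a
      (mulInvariantVectorField X a) : Fin n → ℂ) = -actionField e X (e (a⁻¹ • x)) := by
  let A : G → (Fin n → ℂ) := fun c => e (c • (a⁻¹ • x))
  have hA : MDifferentiableAt 𝓘(ℂ, E) 𝓘(ℂ, Fin n → ℂ) A 1 := by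
    refine MDifferentiableAt.comp (1 : G) (g := e) (mdifferentiableAt_chart he ?_)
      (mdifferentiable_orbit hs (a⁻¹ • x)).mdifferentiableAt
    rwa [one_smul]
  have hΨ : MDifferentiableAt 𝓘(ℂ, E) 𝓘(ℂ, Fin n → ℂ) (fun c : G => e (c⁻¹ • x)) a :=
    MDifferentiableAt.comp a (g := e) (mdifferentiableAt_chart he ha)
      (MDifferentiableAt.comp a (g := fun c : G => c • x)
        (mdifferentiable_orbit hs x).mdifferentiableAt
        (mdifferentiable_inv (E := E)).mdifferentiableAt)
  have hL : MDifferentiableAt 𝓘(ℂ, E) 𝓘(ℂ, E) (fun c : G => a * c) 1 :=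
    (contMDiff_mul_left (I := 𝓘(ℂ, E)) (n := ω)).mdifferentiable (by simp) 1
  have h1 := mfderiv_comp_apply_of_eq (1 : G) hΨ hL (mul_one a) X
  have h2 := mfderiv_comp_apply_of_eq (1 : G) hA (mdifferentiable_inv (E := E)).mdifferentiableAt
    inv_one X
  -- This is `(a c)⁻¹ x = c⁻¹ (a⁻¹ x)`; the minus sign is the differential of the inversion.
  have h3 : (fun c : G => e (c⁻¹ • x)) ∘ (fun c : G => a * c) = A ∘ fun c : G => c⁻¹ := by
    funext c
    simp [A, mul_smul]
  have h4 : actionField e X (e (a⁻¹ • x)) = mfderiv 𝓘(ℂ, E) 𝓘(ℂ, Fin n → ℂ) A 1 X := by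
    rw [actionField, e.left_inv ha]
  rw [h3] at h1
  have h5 : (mfderiv 𝓘(ℂ, E) 𝓘(ℂ, Fin n → ℂ) A 1
      (mfderiv 𝓘(ℂ, E) 𝓘(ℂ, E) (fun c : G => c⁻¹) 1 X : E) : Fin n → ℂ) =
      -(mfderiv 𝓘(ℂ, E) 𝓘(ℂ, Fin n → ℂ) A 1 X : Fin n → ℂ) := by
    rw [mfderiv_inv_one X]
    exact (mfderiv 𝓘(ℂ, E) 𝓘(ℂ, Fin n → ℂ) A 1).map_neg X
  rw [h4]
  exact (h1.symm.trans h2).trans h5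

/-- The map `𝔤 → {vector fields on M}` is an anti-homomorphism of Lie algebras. -/
theorem lieBracket_actionField [CompleteSpace E] [LieGroup 𝓘(ℂ, E) ω G]
    [IsManifold 𝓘(ℂ, Fin n → ℂ) ω M]
    (hs : ContMDiff (𝓘(ℂ, E).prod 𝓘(ℂ, Fin n → ℂ)) 𝓘(ℂ, Fin n → ℂ) ω
      (fun p : G × M => p.1 • p.2))
    (he : e ∈ IsManifold.maximalAtlas 𝓘(ℂ, Fin n → ℂ) ω M) (X Y : GroupLieAlgebra 𝓘(ℂ, E) G)
    {z : Fin n → ℂ} (hz : z ∈ e.target) :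
    VectorField.lieBracket ℂ (actionField e X) (actionField e Y) z = -actionField e ⁅X, Y⁆ z := by
  let φ := extChartAt 𝓘(ℂ, E) (1 : G)
  let x : M := e.symm z
  have hx : x ∈ e.source := e.map_target hz
  have hφ1 : φ.symm (φ 1) = 1 := extChartAt_to_inv (1 : G)
  have hφt : φ.target ∈ nhds (φ 1) := extChartAt_target_mem_nhds (1 : G)
  -- The plain orbit map would relate right-invariant fields to the action, but the bracket of `𝔤`
  -- uses left-invariant ones; hence the inverse. Relatedness to the negatives of the action fields
  -- turns `[-X, -Y] = -[X, Y]` into the anti-homomorphism property.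
  let ψ : E → (Fin n → ℂ) := fun b => e ((φ.symm b)⁻¹ • x)
  have hψ1 : ψ (φ 1) = z := by
    simp only [ψ, hφ1, inv_one, one_smul]
    exact e.right_inv hz
  have hinner : ContMDiffAt 𝓘(ℂ, E) 𝓘(ℂ, Fin n → ℂ) ω (fun b => (φ.symm b)⁻¹ • x) (φ 1) := by
    have h1 : ContMDiffAt 𝓘(ℂ, E) 𝓘(ℂ, E) ω φ.symm (φ 1) :=
      (contMDiffOn_extChartAt_symm (1 : G)).contMDiffAt hφt
    have h2 : ContMDiffAt 𝓘(ℂ, E) 𝓘(ℂ, E) ω (fun b => (φ.symm b)⁻¹) (φ 1) :=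
      ContMDiffAt.comp (φ 1) (contMDiff_inv 𝓘(ℂ, E) ω).contMDiffAt h1
    exact ContMDiffAt.comp (φ 1) (g := fun p : G × M => p.1 • p.2) hs.contMDiffAt
      (h2.prodMk (contMDiffAt_const (c := x)))
  have hψ : ContDiffAt ℂ ω ψ (φ 1) := by
    refine ContMDiffAt.contDiffAt (ContMDiffAt.comp (φ 1) (g := e) ?_ hinner)
    refine contMDiffAt_of_mem_maximalAtlas he ?_
    rwa [hφ1, inv_one, one_smul]
  have hev : ∀ᶠ b in nhds (φ 1), b ∈ φ.target ∧ (φ.symm b)⁻¹ • x ∈ e.source := by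
    refine Filter.Eventually.and hφt (hinner.continuousAt.eventually (e.open_source.mem_nhds ?_))
    change (φ.symm (φ 1))⁻¹ • x ∈ e.source
    rwa [hφ1, inv_one, one_smul]
  have hrel : ∀ Z : GroupLieAlgebra 𝓘(ℂ, E) G, ∀ b, b ∈ φ.target → (φ.symm b)⁻¹ • x ∈ e.source →
      fderiv ℂ ψ b (leftField Z b) = -actionField e Z (ψ b) := by
    intro Z b hb hbx
    have hΨ : MDifferentiableAt 𝓘(ℂ, E) 𝓘(ℂ, Fin n → ℂ) (fun c : G => e (c⁻¹ • x)) (φ.symm b) :=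
      MDifferentiableAt.comp _ (g := e) (mdifferentiableAt_chart he hbx)
        (MDifferentiableAt.comp _ (g := fun c : G => c • x)
          (mdifferentiable_orbit hs x).mdifferentiableAt
          (mdifferentiable_inv (E := E)).mdifferentiableAt)
    have hφb : MDifferentiableAt 𝓘(ℂ, E) 𝓘(ℂ, E) φ.symm b :=
      ((contMDiffOn_extChartAt_symm (n := ω) (1 : G)).contMDiffAt
        ((isOpen_extChartAt_target (1 : G)).mem_nhds hb)).mdifferentiableAt (by simp)
    have h1 := mfderiv_comp_apply b hΨ hφb (leftField Z b : E)
    have h2 := mfderiv_symm_leftField Z hb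
    have h3 := mfderiv_inv_smul_mulInvariantVectorField hs he Z x (φ.symm b) hbx
    rw [← mfderiv_eq_fderiv]
    refine h1.trans (Eq.trans ?_ h3)
    exact congrArg _ h2
  have hd : ∀ Z : GroupLieAlgebra 𝓘(ℂ, E) G, DifferentiableAt ℂ (actionField e Z) z := fun Z =>
    ((contDiffOn_actionField hs he Z).contDiffAt (e.open_target.mem_nhds hz)).differentiableAt
      (by simp)
  have hderiv : ∀ Z W : GroupLieAlgebra 𝓘(ℂ, E) G,
      fderiv ℂ (fun b => fderiv ℂ ψ b (leftField Z b)) (φ 1) (leftField W (φ 1)) =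
        fderiv ℂ (actionField e Z) z (actionField e W z) := by
    intro Z W
    have h1 : (fun b => fderiv ℂ ψ b (leftField Z b)) =ᶠ[nhds (φ 1)]
        fun b => -actionField e Z (ψ b) := hev.mono fun b hb => hrel Z b hb.1 hb.2
    have h2 : HasFDerivAt (fun b => actionField e Z (ψ b))
        ((fderiv ℂ (actionField e Z) z).comp (fderiv ℂ ψ (φ 1))) (φ 1) := by
      refine HasFDerivAt.comp (φ 1) (g := actionField e Z) ?_ (hψ.differentiableAt (by simp)).hasFDerivAt
      rw [hψ1]
      exact (hd Z).hasFDerivAt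
    have h3 := hrel W (φ 1) hev.self_of_nhds.1 hev.self_of_nhds.2
    rw [h1.fderiv_eq, h2.fun_neg.fderiv, neg_apply, ContinuousLinearMap.comp_apply, h3, hψ1,
      map_neg, neg_neg]
  have h1 := VectorField.fderiv_apply_lieBracket hψ le_top (differentiableAt_leftField Y)
    (differentiableAt_leftField X)
  rw [hderiv, hderiv, lieBracket_leftField, ← leftField_apply_one ⁅X, Y⁆,
    hrel _ _ hev.self_of_nhds.1 hev.self_of_nhds.2, hψ1] at h1
  exact h1.symm

end Action

end LieGroupFields

theorem contDiffOn_sum_sum_mul {X ι κ : Type*} [NormedAddCommGroup X] [NormedSpace ℝ X] [Fintype ι]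
    [Fintype κ] {a : ι → κ → X → ℂ} {u : ι → X → ℂ} {w : κ → X → ℂ} {s : Set X}
    (ha : ∀ α β, ContDiffOn ℝ ∞ (a α β) s) (hu : ∀ α, ContDiffOn ℝ ∞ (u α) s)
    (hw : ∀ β, ContDiffOn ℝ ∞ (w β) s) :
    ContDiffOn ℝ ∞ (fun p => ∑ α, ∑ β, a α β p * (u α p * w β p)) s :=
  ContDiffOn.sum fun α _ => ContDiffOn.sum fun β _ => (ha α β).mul ((hu α).mul (hw β))

/-! ### Induced metrics in holomorphic charts -/

section Homogeneous

variable {E : Type*} [NormedAddCommGroup E] [NormedSpace ℂ E]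
  {G : Type*} [TopologicalSpace G] [ChartedSpace E G] [Group G]
  {n : ℕ} {M : Type*} [TopologicalSpace M] [ChartedSpace (Fin n → ℂ) M] [MulAction G M]

instance instFiniteDimensionalTangentSpace (x : M) :
    FiniteDimensional ℂ (TangentSpace 𝓘(ℂ, Fin n → ℂ) x) :=
  inferInstanceAs (FiniteDimensional ℂ (Fin n → ℂ))

/-- At `x = a • o` the orbit map of `x`, precomposed with right translation by `a⁻¹`, is the orbit
map of `o`, a submersion at `a`. -/
theorem IsComplexHomogeneous.ev_surjective [LieGroup 𝓘(ℂ, E) ω G] {H : Subgroup G}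
    (hM : IsComplexHomogeneous E H n M) (x : M) :
    Function.Surjective (ev x : GroupLieAlgebra 𝓘(ℂ, E) G →ₗ[ℂ]
      TangentSpace 𝓘(ℂ, Fin n → ℂ) x) := by
  obtain ⟨o, -, hsurj⟩ := hM.quotient
  have := hM.transitive
  obtain ⟨a, rfl⟩ := MulAction.exists_smul_eq G o x
  intro w
  obtain ⟨v, hv⟩ := hsurj a w
  have hR : MDifferentiableAt 𝓘(ℂ, E) 𝓘(ℂ, E) (fun b : G => b * a⁻¹) a :=
    (contMDiff_mul_right (I := 𝓘(ℂ, E)) (n := ω)).mdifferentiable (by simp) a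
  have h1 := mfderiv_comp_apply_of_eq a
    (mdifferentiable_orbit hM.holomorphic (a • o)).mdifferentiableAt hR (mul_inv_cancel a) v
  have h2 : (fun c : G => c • a • o) ∘ (fun b : G => b * a⁻¹) = fun b : G => b • o := by
    funext b
    simp [mul_smul]
  rw [h2] at h1
  exact ⟨_, h1.symm.trans hv⟩

variable {e : OpenPartialHomeomorph M (Fin n → ℂ)}

/-- The identification of a tangent space with `ℂⁿ` given by a holomorphic chart. -/
def chartEquiv [IsManifold 𝓘(ℂ, Fin n → ℂ) ω M]
    (he : e ∈ IsManifold.maximalAtlas 𝓘(ℂ, Fin n → ℂ) ω M) {z : Fin n → ℂ} (hz : z ∈ e.target) :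
    TangentSpace 𝓘(ℂ, Fin n → ℂ) (e.symm z) ≃ₗ[ℂ] (Fin n → ℂ) :=
  have h1 : MDifferentiableAt 𝓘(ℂ, Fin n → ℂ) 𝓘(ℂ, Fin n → ℂ) e (e.symm z) :=
    mdifferentiableAt_chart he (e.map_target hz)
  have h2 : MDifferentiableAt 𝓘(ℂ, Fin n → ℂ) 𝓘(ℂ, Fin n → ℂ) e.symm z :=
    ((contMDiffOn_symm_of_mem_maximalAtlas he).contMDiffAt
      (e.open_target.mem_nhds hz)).mdifferentiableAt (by simp)
  LinearEquiv.ofLinearMap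
    (mfderiv 𝓘(ℂ, Fin n → ℂ) 𝓘(ℂ, Fin n → ℂ) e (e.symm z)).toLinearMap
    (mfderiv 𝓘(ℂ, Fin n → ℂ) 𝓘(ℂ, Fin n → ℂ) e.symm z).toLinearMap
    (LinearMap.ext fun u => by
      have h := mfderiv_comp_apply_of_eq z h1 h2 rfl u
      have h3 : (e ∘ e.symm) =ᶠ[nhds z] id :=
        (e.open_target.eventually_mem hz).mono fun y hy => e.right_inv hy
      rw [h3.mfderiv_eq, mfderiv_id] at h
      exact h.symm)
    (LinearMap.ext fun u => by
      have h := mfderiv_comp_apply_of_eq (e.symm z) h2 h1 (e.right_inv hz) u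
      have h3 : (e.symm ∘ e) =ᶠ[nhds (e.symm z)] id :=
        (e.open_source.eventually_mem (e.map_target hz)).mono fun y hy => e.left_inv hy
      rw [h3.mfderiv_eq, mfderiv_id] at h
      exact h.symm)

/-- The pullback to `𝔤` of the covector `dz_i` under the evaluation map. -/
def actionCovector (e : OpenPartialHomeomorph M (Fin n → ℂ)) (z : Fin n → ℂ) (i : Fin n) :
    Module.Dual ℂ (GroupLieAlgebra 𝓘(ℂ, E) G) :=
  (LinearMap.proj i).comp
    (mfderiv 𝓘(ℂ, E) 𝓘(ℂ, Fin n → ℂ) (fun a : G => e (a • e.symm z)) 1).toLinearMap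

omit [ChartedSpace (Fin n → ℂ) M] in
theorem actionCovector_apply (z : Fin n → ℂ) (i : Fin n) (X : GroupLieAlgebra 𝓘(ℂ, E) G) :
    actionCovector e z i X = actionField e X z i := rfl

/-- The matrix of `ev_* h` in a chart, transposed. -/
def dualGram (h : SesqForm (Module.Dual ℂ (GroupLieAlgebra 𝓘(ℂ, E) G)))
    (e : OpenPartialHomeomorph M (Fin n → ℂ)) (z : Fin n → ℂ) : Matrix (Fin n) (Fin n) ℂ :=
  Matrix.of fun j i => h (actionCovector e z i) (actionCovector e z j)

omit [ChartedSpace (Fin n → ℂ) M] in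
theorem dualGram_apply (h : SesqForm (Module.Dual ℂ (GroupLieAlgebra 𝓘(ℂ, E) G)))
    (z : Fin n → ℂ) (j i : Fin n) :
    dualGram h e z j i = h (actionCovector e z i) (actionCovector e z j) := rfl

omit [ChartedSpace (Fin n → ℂ) M] in
theorem dualGram_apply_eq_sum {ι : Type*} [Fintype ι]
    (b : Module.Basis ι ℂ (GroupLieAlgebra 𝓘(ℂ, E) G))
    (h : SesqForm (Module.Dual ℂ (GroupLieAlgebra 𝓘(ℂ, E) G))) (z : Fin n → ℂ) (j i : Fin n) :
    dualGram h e z j i = ∑ α, ∑ β, h (b.coord α) (b.coord β) *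
      (actionField e (b α) z i * conj (actionField e (b β) z j)) :=
  form_apply_eq_sum b h _ _

omit [ChartedSpace (Fin n → ℂ) M] in
theorem dualGram_eq_of_sum {ι : Type*} [Fintype ι]
    {h : SesqForm (Module.Dual ℂ (GroupLieAlgebra 𝓘(ℂ, E) G))}
    {f : ι → GroupLieAlgebra 𝓘(ℂ, E) G} (hf : h = ∑ μ, tensorForm (f μ) (f μ))
    (z : Fin n → ℂ) :
    dualGram h e z = (frame (fun μ => actionField e (f μ)) z).conjTranspose *
      frame (fun μ => actionField e (f μ)) z := by
  ext j i
  simp only [dualGram, hf, Matrix.of_apply, LinearMap.sum_apply, tensorForm_apply,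
    Matrix.mul_apply, Matrix.conjTranspose_apply, frame, actionCovector_apply]
  exact Finset.sum_congr rfl fun μ _ => mul_comm _ _

/-- By `pushForm_inv` the induced metric is the inverse of the image of `h` in `T_x M`. The
transposition in the matrix of an inverse form is built into `dualGram`. -/
theorem coeffs_mul_dualGram [FiniteDimensional ℂ E] [LieGroup 𝓘(ℂ, E) ω G]
    [IsManifold 𝓘(ℂ, Fin n → ℂ) ω M] {H : Subgroup G} (hM : IsComplexHomogeneous E H n M)
    (he : e ∈ IsManifold.maximalAtlas 𝓘(ℂ, Fin n → ℂ) ω M)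
    {h : Sym11 (GroupLieAlgebra 𝓘(ℂ, E) G)} (hp : IsPositive h.1) {z : Fin n → ℂ}
    (hz : z ∈ e.target) : coeffs (evPush h.inv) e z * dualGram h.1 e z = 1 := by
  have hs := hM.ev_surjective (e.symm z)
  let b := Module.Basis.ofEquivFun (chartEquiv he hz)
  have hb : ∀ i, b i = coordVec e z i := fun i => by
    rw [Module.Basis.coe_ofEquivFun]
    rfl
  have hc : ∀ i, (b.coord i).comp (ev (e.symm z)) = actionCovector (E := E) (G := G) e z i :=
    fun i => LinearMap.ext fun X => by
      rw [actionCovector_apply, actionField_eq hM.holomorphic he X hz]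
      rfl
  ext l i
  have h1 := sum_mul_inv_eq (Sym11.isPositive_map hp hs) b i l
  rw [Matrix.mul_apply, Matrix.one_apply]
  simp only [Sym11.map_apply, hc, hb] at h1
  simp only [eq_comm (a := l)]
  rw [← h1]
  refine Finset.sum_congr rfl fun j _ => ?_
  simp only [coeffs, evPush, pushForm_inv hp hs, dualGram, Matrix.of_apply]
  exact mul_comm _ _

end Homogeneous

/-! ### The induced flow solves the HCF -/

section MainTheorem

variable {E : Type*} [NormedAddCommGroup E] [NormedSpace ℂ E] [FiniteDimensional ℂ E]
  [CompleteSpace E] {G : Type*} [TopologicalSpace G] [ChartedSpace E G] [Group G]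
  [LieGroup 𝓘(ℂ, E) ω G]
  {n : ℕ} {M : Type*} [TopologicalSpace M] [ChartedSpace (Fin n → ℂ) M]
  [IsManifold 𝓘(ℂ, Fin n → ℂ) ω M] [MulAction G M]

theorem contDiffOn_coeffs {h₀ : Sym11 (GroupLieAlgebra 𝓘(ℂ, E) G)} (hp : IsPositive h₀.1)
    {τ : EReal} (hτ : 0 < τ) {h : ℝ → Sym11 (GroupLieAlgebra 𝓘(ℂ, E) G)}
    (hh : IsSharpFlow h₀ τ h) {H : Subgroup G} (hM : IsComplexHomogeneous E H n M)
    {e : OpenPartialHomeomorph M (Fin n → ℂ)}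
    (he : e ∈ IsManifold.maximalAtlas 𝓘(ℂ, Fin n → ℂ) ω M) (i j : Fin n) :
    ContDiffOn ℝ ∞ (fun p : ℝ × (Fin n → ℂ) =>
      coeffs (n := n) (M := M) (evPush (h p.1).inv) e p.2 i j) (timeInterval τ ×ˢ e.target) := by
  let b := Module.finBasis ℂ (GroupLieAlgebra 𝓘(ℂ, E) G)
  have h1 : ∀ α β, ContDiffOn ℝ ∞ (fun p : ℝ × (Fin n → ℂ) => (h p.1).1 (b.coord α) (b.coord β))
      (timeInterval τ ×ˢ e.target) := fun α β =>
    (hh.contDiffOn hτ _ _).comp contDiffOn_fst fun p hpm => hpm.1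
  have h2 : ∀ α m, ContDiffOn ℝ ∞ (fun p : ℝ × (Fin n → ℂ) => actionField e (b α) p.2 m)
      (timeInterval τ ×ˢ e.target) := fun α m =>
    (contDiffOn_pi.1 ((contDiffOn_actionField hM.holomorphic he (b α)).restrict_scalars ℝ) m).comp
      contDiffOn_snd fun p hpm => hpm.2
  have h3 : ∀ α m, ContDiffOn ℝ ∞ (fun p : ℝ × (Fin n → ℂ) => conj (actionField e (b α) p.2 m))
      (timeInterval τ ×ˢ e.target) := fun α m =>
    Complex.conjCLE.contDiff.comp_contDiffOn (h2 α m)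
  have hB : ∀ k l, ContDiffOn ℝ ∞ (fun p : ℝ × (Fin n → ℂ) => dualGram (h p.1).1 e p.2 k l)
      (timeInterval τ ×ˢ e.target) := fun k l => by
    simp only [dualGram_apply_eq_sum b]
    exact contDiffOn_sum_sum_mul h1 (fun α => h2 α l) fun β => h3 β k
  exact contDiffOn_of_mul_eq_one hB
    (fun p hpm => coeffs_mul_dualGram hM he (hh.isPositive hp hpm.1) hpm.2) i j

theorem torsionTwistedRicci_coeffs {h : Sym11 (GroupLieAlgebra 𝓘(ℂ, E) G)} (hp : IsPositive h.1)
    {H : Subgroup G} (hM : IsComplexHomogeneous E H n M)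
    {e : OpenPartialHomeomorph M (Fin n → ℂ)}
    (he : e ∈ IsManifold.maximalAtlas 𝓘(ℂ, Fin n → ℂ) ω M) {z : Fin n → ℂ} (hz : z ∈ e.target)
    (i j : Fin n) :
    torsionTwistedRicci (coeffs (n := n) (M := M) (evPush h.inv) e) z i j =
      (coeffs (n := n) (M := M) (evPush h.inv) e z * dualGram h.sharpSq.1 e z *
        coeffs (n := n) (M := M) (evPush h.inv) e z) i j := by
  obtain ⟨f, hf⟩ := exists_eq_sum_tensorForm h.1 h.2 hp
  have hv : ∀ μ, ContDiffOn ℂ 2 (actionField e (f μ)) e.target := fun μ =>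
    contDiffOn_infty.1 (contDiffOn_actionField hM.holomorphic he (f μ)) 2
  refine torsionTwistedRicci_eq e.open_target hv (fun y hy => ?_) hz (fun k l => ?_) i j
  · rw [← dualGram_eq_of_sum hf]
    exact coeffs_mul_dualGram hM he hp hy
  -- Each bracket of action fields carries a minus sign, which cancels against that of its
  -- conjugate.
  · simp only [dualGram_apply, sharpSq_eq_sum hf, LinearMap.smul_apply,
      LinearMap.sum_apply, tensorForm_apply, actionCovector_apply, smul_eq_mul,
      lieBracket_actionField hM.holomorphic he _ _ hz, Pi.neg_apply, map_neg, neg_mul_neg]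

/-- `dualGram` is linear in `h`, so along the flow its derivative is that of `h^#`; inverting the
matrix gives exactly the product found in `torsionTwistedRicci_coeffs`, with a minus sign. -/
theorem hasDerivWithinAt_coeffs {h₀ : Sym11 (GroupLieAlgebra 𝓘(ℂ, E) G)}
    (hp : IsPositive h₀.1) {τ : EReal} (hτ : 0 < τ)
    {h : ℝ → Sym11 (GroupLieAlgebra 𝓘(ℂ, E) G)}
    (hh : IsSharpFlow h₀ τ h) {H : Subgroup G} (hM : IsComplexHomogeneous E H n M) {t : ℝ}
    (ht : t ∈ timeInterval τ) {e : OpenPartialHomeomorph M (Fin n → ℂ)}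
    (he : e ∈ IsManifold.maximalAtlas 𝓘(ℂ, Fin n → ℂ) ω M) {z : Fin n → ℂ} (hz : z ∈ e.target)
    (i j : Fin n) :
    HasDerivWithinAt (fun s => coeffs (n := n) (M := M) (evPush (h s).inv) e z i j)
      (-torsionTwistedRicci (coeffs (n := n) (M := M) (evPush (h t).inv) e) z i j)
      (timeInterval τ) t := by
  rw [torsionTwistedRicci_coeffs (hh.isPositive hp ht) hM he hz, ← Matrix.neg_apply]
  have hA : ∀ k l, DifferentiableWithinAt ℝ
      (fun s => coeffs (n := n) (M := M) (evPush (h s).inv) e z k l) (timeInterval τ) t :=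
    fun k l => by
      have h1 := (contDiffOn_coeffs hp hτ hh hM he k l).comp
        (contDiffOn_id.prodMk (contDiffOn_const (c := z)))
        fun s (hs : s ∈ timeInterval τ) => ⟨hs, hz⟩
      exact h1.differentiableOn (by simp) t ht
  have hB : ∀ k l, HasDerivWithinAt (fun s => dualGram (h s).1 e z k l)
      (dualGram (h t).sharpSq.1 e z k l) (timeInterval τ) t := fun k l => by
    simp only [dualGram_apply]
    exact hh.flow t ht (actionCovector e z l) (actionCovector e z k)
  exact hasDerivWithinAt_of_mul_eq_one ht (uniqueDiffOn_timeInterval hτ t ht) hA hB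
    (fun s hs => coeffs_mul_dualGram hM he (hh.isPositive hp hs) hz) i j

theorem isHCFSolution_evPush {h₀ : Sym11 (GroupLieAlgebra 𝓘(ℂ, E) G)} (hp : IsPositive h₀.1)
    {τ : EReal} (hτ : 0 < τ) {h : ℝ → Sym11 (GroupLieAlgebra 𝓘(ℂ, E) G)}
    (hh : IsSharpFlow h₀ τ h) {H : Subgroup G} (hM : IsComplexHomogeneous E H n M) :
    IsHCFSolution (evPush (n := n) (M := M) h₀.inv) τ (fun t => evPush (h t).inv) where
  initial := by rw [hh.initial]
  metric t ht x := by
    have hpt := hh.isPositive hp ht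
    change IsHermitianInner (pushForm (h t).inv (ev x))
    rw [pushForm_inv hpt (hM.ev_surjective x)]
    exact isHermitianInner_inv (Sym11.isPositive_map hpt (hM.ev_surjective x))
  smooth _ he i j := contDiffOn_coeffs hp hτ hh hM he i j
  flow _ ht _ he _ hz i j := hasDerivWithinAt_coeffs hp hτ hh hM ht he hz i j

omit [IsManifold 𝓘(ℂ, Fin n → ℂ) ω M] in
theorem IsSharpFlow.evPush_mem_inducedMetrics {h₀ : Sym11 (GroupLieAlgebra 𝓘(ℂ, E) G)}
    (hp : IsPositive h₀.1) {τ : EReal} {h : ℝ → Sym11 (GroupLieAlgebra 𝓘(ℂ, E) G)}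
    (hh : IsSharpFlow h₀ τ h) {t : ℝ} (ht : t ∈ timeInterval τ) :
    evPush (h t).inv ∈ inducedMetrics E G n M :=
  ⟨(h t).inv, isHermitianInner_inv (hh.isPositive hp ht), rfl⟩

end MainTheorem

end HCF

end

theorem mainTheorem1
    {E : Type*} [NormedAddCommGroup E] [NormedSpace ℂ E] [FiniteDimensional ℂ E] [CompleteSpace E]
    {G : Type*} [TopologicalSpace G] [ChartedSpace E G] [Group G] [LieGroup 𝓘(ℂ, E) ω G] :
    (∀ (h₀ : HCF.Sym11 (GroupLieAlgebra 𝓘(ℂ, E) G)), HCF.IsPositive h₀.1 →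
      ∀ (τ : EReal), 0 < τ → ∀ (h : ℝ → HCF.Sym11 (GroupLieAlgebra 𝓘(ℂ, E) G)),
      HCF.IsSharpFlow h₀ τ h →
      ∀ (H : Subgroup G) (n : ℕ) (M : Type*) [TopologicalSpace M] [ChartedSpace (Fin n → ℂ) M]
        [IsManifold 𝓘(ℂ, Fin n → ℂ) ω M] [MulAction G M],
        HCF.IsComplexHomogeneous E H n M →
        HCF.IsHCFSolution (HCF.evPush (n := n) (M := M) h₀.inv) τ
            (fun t => HCF.evPush (h t).inv) ∧
          ∀ t ∈ HCF.timeInterval τ,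
            HCF.evPush (h t).inv ∈ HCF.inducedMetrics E G n M) ∧
    (∀ (H : Subgroup G) (n : ℕ) (M : Type*) [TopologicalSpace M] [ChartedSpace (Fin n → ℂ) M]
        [IsManifold 𝓘(ℂ, Fin n → ℂ) ω M] [MulAction G M],
        HCF.IsComplexHomogeneous E H n M →
        ∀ g₀ ∈ HCF.inducedMetrics E G n M, ∃ τ : EReal, 0 < τ ∧ ∃ g : ℝ → HCF.FormField n M,
          HCF.IsHCFSolution g₀ τ g ∧
            ∀ t ∈ HCF.timeInterval τ, g t ∈ HCF.inducedMetrics E G n M) := by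
  refine ⟨fun h₀ hp τ hτ h hh H n M _ _ _ _ hM => ⟨HCF.isHCFSolution_evPush hp hτ hh hM,
    fun t ht => hh.evPush_mem_inducedMetrics hp ht⟩, ?_⟩
  rintro H n M _ _ _ _ hM g₀ ⟨k, hk, rfl⟩
  obtain ⟨h₀, hp, rfl⟩ := HCF.exists_inv_eq hk
  obtain ⟨ε, hε, h, hh⟩ := HCF.exists_isSharpFlow h₀
  have hε' : (0 : EReal) < ε := by exact_mod_cast hε
  exact ⟨ε, hε', fun t => HCF.evPush (h t).inv, HCF.isHCFSolution_evPush hp hε' hh hM,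
    fun t ht => hh.evPush_mem_inducedMetrics hp ht⟩
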